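/- Let $c>0$ (sound speed), $\mu>0$ and $\lambda\in\mathbb R$ with $\nu:=\lambda+2\mu>0$. For functions on $\mathbb R^2$ use the Fourier transform $\widehat f(\eta)=\int_{\mathbb R^2}f(x)\,e^{i\eta\cdot x}\,dx$. Let $S_\shortparallel(t)$ be the Green kernel of the linearised curl-free system $$\partial_t\widetilde\rho+\mathrm{div}\,m=0,\qquad \partial_t m+c^2\nabla\widetilde\rho=\nu\,\Delta m\qquad(m\text{ curl-free}),$$ that is, the $3\times3$ matrix-valued kernel acting on $(\widetilde\rho,m)$ given by $$\widehat{S_\shortparallel}(t,\eta)=\begin{bmatrix}\dfrac{\lambda^+e^{\lambda^-t}-\lambda^-e^{\lambda^+t}}{\lambda^+-\lambda^-}& i\,\dfrac{e^{\lambda^+t}-e^{\lambda^-t}}{\lambda^+-\lambda^-}\,{}^t\eta\\[2ex] i\,c^2\,\dfrac{e^{\lambda^+t}-e^{\lambda^-t}}{\lambda^+-\lambda^-}\,\eta&\dfrac{\lambda^+e^{\lambda^+t}-\lambda^-e^{\lambda^-t}}{\lambda^+-\lambda^-}\,I_2\end{bmatrix},\qquad \lambda^\pm(\eta)=-\tfrac12\nu|\eta|^2\pm\tfrac12\sqrt{\nu^2|\eta|^4-4c^2|\eta|^2}\,,$$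 and let $\widetilde S_\shortparallel(t)$ be the Green kernel of the artificial viscosity system $$\partial_t\widetilde\rho+\mathrm{div}\,m=\tfrac{\nu}{2}\Delta\widetilde\rho,\qquad \partial_t m+c^2\nabla\widetilde\rho=\tfrac{\nu}{2}\Delta m\qquad(m\text{ curl-free}),$$ that is, $$\widetilde S_\shortparallel=\begin{bmatrix}\partial_tw\star K&-\nabla{}^tw\star K\\-c^2\nabla w\star K&(\partial_tw\star K)\,I_2\end{bmatrix},\qquad \widehat w(t,\eta)=\frac{\sin(c|\eta|t)}{c|\eta|},\quad \widehat K(t,\eta)=e^{-\frac{\nu}{2}|\eta|^2t}.$$ Let $R_0>0$ and let $\chi:\mathbb R^2\to[0,1]$ be smooth, equal to $1$ for $|\eta|\le R_0$ and to $0$ for $|\eta|\ge R_0+1$. The low-frequency parts $S_\shortparallel^{LF}(t)$ and $\widetilde S_\shortparallel^{LF}(t)$ are the matrix-valued functions of $x$ with Fourier transforms $\chi\,\widehat{S_\shortparallel}(t)$ and $\chi\,\widehat{\widetilde S_\shortparallel}(t)$. The $L^p$ norm of a matrix-valued function on $\mathbb R^2$ is the maximum of the $L^p$ norms of its entries. For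 $t\ge1$ both low-frequency parts are smooth functions of $x$, and (all constants may depend on $c,\mu,\lambda,\chi$): 1. For every multi-index $\sigma\in\mathbb N^2$ there is a constant $C_\sigma>0$ such that for all $t\ge1$ and all $2\le p\le\infty$, $$\big\|D^\sigma\big(S_\shortparallel^{LF}(t)-\widetilde S_\shortparallel^{LF}(t)\big)\big\|_{L^p}\le C_\sigma\,t^{-\left(1-\frac1p+\frac{|\sigma|}2+\frac12\right)}.$$ 2. For every multi-index $\sigma\in\mathbb N^2$ and every real $\theta>0$ there is a constant $C_{\sigma,\theta}>0$ such that for all $t\ge1$ and all $1\le p\le2$, $$\big\|D^\sigma\big(S_\shortparallel^{LF}(t)-\widetilde S_\shortparallel^{LF}(t)\big)\big\|_{L^p}\le C_{\sigma,\theta}\,t^{-\left(\frac54-\frac3{2p}+\frac{|\sigma|}2+\frac12-\theta\right)}.$$ -/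

import Mathlib

open scoped ENNReal ContDiff

noncomputable section

namespace ViscousFlow

/-- The plane `ℝ²` with its Euclidean norm. -/
abbrev Plane : Type := EuclideanSpace ℝ (Fin 2)

/-- Index of a state `(ρ̃, m)`: one density component and two momentum components. -/
abbrev StateIdx : Type := Unit ⊕ Fin 2

/-- The block matrix `[[a, b ᵗη], [d η, e I₂]]`. -/
def blockSymbol (a b d e : ℂ) (η : Plane) : Matrix StateIdx StateIdx ℂ :=
  Matrix.fromBlocks
    (Matrix.of fun _ _ => a) (Matrix.of fun _ j => b * (η j : ℂ))
    (Matrix.of fun i _ => d * (η i : ℂ)) (e • (1 : Matrix (Fin 2) (Fin 2) ℂ))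

/-!
Fourier convention: `f̂(η) = ∫ f(x) exp(i η·x) dx`, so that `∂ⱼ` becomes multiplication by `-i ηⱼ`.
Below `c` is the sound speed and `ν = lam + 2 μ` the viscosity of the curl-free part.
-/

/-- Fourier symbol of the generator of
`∂ₜ ρ̃ + div m = 0`, `∂ₜ m + c² ∇ρ̃ = ν Δ m`. -/
def curlFreeGenerator (c ν : ℝ) (η : Plane) : Matrix StateIdx StateIdx ℂ :=
  blockSymbol 0 Complex.I (Complex.I * (c : ℂ) ^ 2) (-((ν : ℂ) * (‖η‖ : ℂ) ^ 2)) η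

/-- Fourier symbol of the generator of the artificial viscosity system
`∂ₜ ρ̃ + div m = (ν/2) Δ ρ̃`, `∂ₜ m + c² ∇ρ̃ = (ν/2) Δ m`. -/
def artificialGenerator (c ν : ℝ) (η : Plane) : Matrix StateIdx StateIdx ℂ :=
  blockSymbol (-((ν : ℂ) / 2 * (‖η‖ : ℂ) ^ 2)) Complex.I (Complex.I * (c : ℂ) ^ 2)
    (-((ν : ℂ) / 2 * (‖η‖ : ℂ) ^ 2)) η

/-- A complex square root of `ν² |η|⁴ - 4 c² |η|²`. -/
def discRoot (c ν : ℝ) (η : Plane) : ℂ :=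
  ((ν ^ 2 * ‖η‖ ^ 4 - 4 * c ^ 2 * ‖η‖ ^ 2 : ℝ) : ℂ) ^ (1 / 2 : ℂ)

/-- The eigenvalue `λ⁺(η)`. -/
def eigPlus (c ν : ℝ) (η : Plane) : ℂ :=
  -(1 / 2) * (ν : ℂ) * (‖η‖ : ℂ) ^ 2 + 1 / 2 * discRoot c ν η

/-- The eigenvalue `λ⁻(η)`. -/
def eigMinus (c ν : ℝ) (η : Plane) : ℂ :=
  -(1 / 2) * (ν : ℂ) * (‖η‖ : ℂ) ^ 2 - 1 / 2 * discRoot c ν η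

/-- Fourier transform of the Green kernel `S_∥(t)` of the curl-free system. The formula has removable
singularities where `λ⁺ = λ⁻`, that is at `η = 0` and on the circle `|η| = 2c/ν`; this is a null set,
and the values taken there play no role. -/
def curlFreeSymbol (c ν t : ℝ) (η : Plane) : Matrix StateIdx StateIdx ℂ :=
  let lp := eigPlus c ν η
  let lm := eigMinus c ν η
  let A := (Complex.exp (lp * t) - Complex.exp (lm * t)) / (lp - lm)
  blockSymbol
    ((lp * Complex.exp (lm * t) - lm * Complex.exp (lp * t)) / (lp - lm))
    (Complex.I * A)
    (Complex.I * (c : ℂ) ^ 2 * A)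
    ((lp * Complex.exp (lp * t) - lm * Complex.exp (lm * t)) / (lp - lm)) η

/-- Fourier transform of the solution `w` of `∂ₜ² w = c² Δ w`, `w(0) = 0`, `∂ₜ w(0) = δ₀`
(at `η = 0` the value is irrelevant). -/
def waveSymbol (c t : ℝ) (η : Plane) : ℝ :=
  Real.sin (c * ‖η‖ * t) / (c * ‖η‖)

/-- Fourier transform of `∂ₜ w`. -/
def waveDerivSymbol (c t : ℝ) (η : Plane) : ℝ :=
  Real.cos (c * ‖η‖ * t)

/-- Fourier transform of the heat kernel of `∂ₜ f = κ Δ f`. -/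
def heatSymbol (κ t : ℝ) (η : Plane) : ℝ :=
  Real.exp (-(κ * ‖η‖ ^ 2 * t))

/-- Fourier transform of the Green kernel
`S̃_∥ = [[∂ₜw ⋆ K, -∇ᵗw ⋆ K], [-c² ∇w ⋆ K, ∂ₜw ⋆ K]]`, `K` being the heat kernel of viscosity `ν/2`,
of the artificial viscosity system. -/
def artificialSymbol (c ν t : ℝ) (η : Plane) : Matrix StateIdx StateIdx ℂ :=
  blockSymbol
    (waveDerivSymbol c t η * heatSymbol (ν / 2) t η : ℝ)
    (Complex.I * (waveSymbol c t η * heatSymbol (ν / 2) t η : ℝ))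
    (Complex.I * (c : ℂ) ^ 2 * (waveSymbol c t η * heatSymbol (ν / 2) t η : ℝ))
    (waveDerivSymbol c t η * heatSymbol (ν / 2) t η : ℝ) η

/-- The Fourier transform of a state with curl-free momentum: `(r, a η)`. -/
def curlFreeState (r a : ℂ) (η : Plane) : StateIdx → ℂ :=
  Sum.elim (fun _ => r) (fun j => a * (η j : ℂ))

theorem blockSymbol_mulVec (a b d e r s : ℂ) (η : Plane) :
    (blockSymbol a b d e η).mulVec (curlFreeState r s η) =
      curlFreeState (a * r + b * s * (‖η‖ : ℂ) ^ 2) (d * r + e * s) η := by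
  have hn : ((‖η‖ : ℂ)) ^ 2 = (η 0 : ℂ) ^ 2 + (η 1 : ℂ) ^ 2 := by
    have h := EuclideanSpace.norm_sq_eq η
    simp only [Fin.sum_univ_two, Real.norm_eq_abs, sq_abs] at h
    exact_mod_cast h
  rw [hn]
  funext i
  rcases i with i | i
  · simp [blockSymbol, curlFreeState, Matrix.mulVec, dotProduct, Fin.sum_univ_two]
    ring
  · fin_cases i <;>
      simp [blockSymbol, curlFreeState, Matrix.mulVec, dotProduct, Fin.sum_univ_two] <;> ring

theorem hasDerivAt_curlFreeState {r s : ℝ → ℂ} {r' s' : ℂ} {t : ℝ} (η : Plane)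
    (hr : HasDerivAt r r' t) (hs : HasDerivAt s s' t) :
    HasDerivAt (fun u => curlFreeState (r u) (s u) η) (curlFreeState r' s' η) t := by
  rw [hasDerivAt_pi]
  rintro (i | i)
  · exact hr
  · exact hs.mul_const _

theorem eig_root (c ν : ℝ) (η : Plane) :
    eigPlus c ν η + eigMinus c ν η = -((ν : ℂ) * (‖η‖ : ℂ) ^ 2) ∧
      eigPlus c ν η * eigMinus c ν η = (c : ℂ) ^ 2 * (‖η‖ : ℂ) ^ 2 := by
  have h : discRoot c ν η ^ 2 =
      (ν : ℂ) ^ 2 * (‖η‖ : ℂ) ^ 4 - 4 * (c : ℂ) ^ 2 * (‖η‖ : ℂ) ^ 2 := by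
    have h2 := Complex.cpow_nat_inv_pow
      ((ν ^ 2 * ‖η‖ ^ 4 - 4 * c ^ 2 * ‖η‖ ^ 2 : ℝ) : ℂ) (n := 2) two_ne_zero
    simp only [Nat.cast_ofNat, inv_eq_one_div] at h2
    rw [discRoot, h2]
    push_cast
    ring
  refine ⟨by simp only [eigPlus, eigMinus]; ring, ?_⟩
  simp only [eigPlus, eigMinus]
  linear_combination (-1 / 4 : ℂ) * h

theorem hasDerivAt_cexp (z : ℂ) (t : ℝ) :
    HasDerivAt (fun u : ℝ => Complex.exp (z * u)) (z * Complex.exp (z * t)) t := by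
  have h := ((Complex.ofRealCLM.hasDerivAt (x := t)).const_mul z).cexp
  simp only [Complex.ofRealCLM_apply, Complex.ofReal_one, mul_one] at h
  rwa [mul_comm] at h

/-- `curlFreeSymbol` propagates curl-free data along the Fourier-transformed curl-free system. -/
theorem curlFreeSymbol_isGreen (c ν : ℝ) (η : Plane)
    (h : eigPlus c ν η ≠ eigMinus c ν η) (r a : ℂ) :
    (curlFreeSymbol c ν 0 η).mulVec (curlFreeState r a η) = curlFreeState r a η ∧
    ∀ t : ℝ, HasDerivAt (fun u => (curlFreeSymbol c ν u η).mulVec (curlFreeState r a η))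
      ((curlFreeGenerator c ν η).mulVec
        ((curlFreeSymbol c ν t η).mulVec (curlFreeState r a η))) t := by
  obtain ⟨h1, h2⟩ := eig_root c ν η
  have hd : eigPlus c ν η - eigMinus c ν η ≠ 0 := sub_ne_zero.mpr h
  simp only [curlFreeSymbol, curlFreeGenerator, blockSymbol_mulVec]
  set p := eigPlus c ν η
  set m := eigMinus c ν η
  refine ⟨?_, fun t => ?_⟩
  · simp only [Complex.ofReal_zero, mul_zero, Complex.exp_zero, mul_one, sub_self, zero_div,
      zero_mul, add_zero, div_self hd, one_mul, zero_add]
  · have hp := hasDerivAt_cexp p t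
    have hm := hasDerivAt_cexp m t
    have hB := ((hm.const_mul p).sub (hp.const_mul m)).div_const (p - m)
    have hA := (hp.sub hm).div_const (p - m)
    have hD := ((hp.const_mul p).sub (hm.const_mul m)).div_const (p - m)
    have hr := (hB.mul_const r).add
      (((hA.const_mul Complex.I).mul_const a).mul_const ((‖η‖ : ℂ) ^ 2))
    have hs := ((hA.const_mul (Complex.I * (c : ℂ) ^ 2)).mul_const r).add (hD.mul_const a)
    refine (hasDerivAt_curlFreeState η hr hs).congr_deriv ?_
    congr 1
    · generalize Complex.exp (p * t) = ep
      generalize Complex.exp (m * t) = em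
      field_simp
      linear_combination (ep - em) *
        (-r * h2 - r * (c : ℂ) ^ 2 * (‖η‖ : ℂ) ^ 2 * (Complex.I_sq))
    · rw [← h1]
      generalize Complex.exp (p * t) = ep
      generalize Complex.exp (m * t) = em
      field_simp
      linear_combination (ep - em) *
        (-a * h2 - a * (c : ℂ) ^ 2 * (‖η‖ : ℂ) ^ 2 * (Complex.I_sq))

/-- `artificialSymbol` propagates curl-free data along the Fourier-transformed artificial viscosity
system. -/
theorem artificialSymbol_isGreen (c ν : ℝ) (hc : c ≠ 0) (η : Plane) (hη : η ≠ 0) (r a : ℂ) :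
    (artificialSymbol c ν 0 η).mulVec (curlFreeState r a η) = curlFreeState r a η ∧
    ∀ t : ℝ, HasDerivAt (fun u => (artificialSymbol c ν u η).mulVec (curlFreeState r a η))
      ((artificialGenerator c ν η).mulVec
        ((artificialSymbol c ν t η).mulVec (curlFreeState r a η))) t := by
  have hn : ‖η‖ ≠ 0 := norm_ne_zero_iff.mpr hη
  simp only [artificialSymbol, artificialGenerator, blockSymbol_mulVec]
  refine ⟨?_, fun t => ?_⟩
  · simp [waveSymbol, waveDerivSymbol, heatSymbol]
  · have hl : HasDerivAt (fun u : ℝ => c * ‖η‖ * u) (c * ‖η‖) t := by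
      simpa using (hasDerivAt_id t).const_mul (c * ‖η‖)
    have hk : HasDerivAt (fun u : ℝ => heatSymbol (ν / 2) u η)
        (-(ν / 2 * ‖η‖ ^ 2) * heatSymbol (ν / 2) t η) t := by
      have h := ((hasDerivAt_id t).const_mul (ν / 2 * ‖η‖ ^ 2)).neg.exp
      refine h.congr_deriv ?_
      simp [heatSymbol, mul_comm]
    have hw : HasDerivAt (fun u : ℝ => waveSymbol c u η) (waveDerivSymbol c t η) t := by
      refine (hl.sin.div_const (c * ‖η‖)).congr_deriv ?_
      simp only [waveDerivSymbol]
      field_simp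
    have hv : HasDerivAt (fun u : ℝ => waveDerivSymbol c u η)
        (-(c ^ 2 * ‖η‖ ^ 2) * waveSymbol c t η) t := by
      refine hl.cos.congr_deriv ?_
      simp only [waveSymbol]
      field_simp
    have hB := (hv.mul hk).ofReal_comp
    have hA := (hw.mul hk).ofReal_comp
    have hr := (hB.mul_const r).add
      (((hA.const_mul Complex.I).mul_const a).mul_const ((‖η‖ : ℂ) ^ 2))
    have hs := ((hA.const_mul (Complex.I * (c : ℂ) ^ 2)).mul_const r).add (hB.mul_const a)
    refine (hasDerivAt_curlFreeState η hr hs).congr_deriv ?_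
    congr 1
    · push_cast
      linear_combination (-(r * (c : ℂ) ^ 2 * (‖η‖ : ℂ) ^ 2 *
        (waveSymbol c t η : ℂ) * (heatSymbol (ν / 2) t η : ℂ))) * Complex.I_sq
    · push_cast
      linear_combination (-(a * (c : ℂ) ^ 2 * (‖η‖ : ℂ) ^ 2 *
        (waveSymbol c t η : ℂ) * (heatSymbol (ν / 2) t η : ℂ))) * Complex.I_sq

/-- Admissible low-frequency cut-off: smooth, with values in `[0,1]`, equal to one for `|η| ≤ R₀` and
to zero for `|η| ≥ R₀ + 1`. -/
structure IsCutoff (R₀ : ℝ) (χ : Plane → ℝ) : Prop where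
  smooth : ContDiff ℝ ∞ χ
  mem_Icc : ∀ η, χ η ∈ Set.Icc (0 : ℝ) 1
  eq_one : ∀ η, ‖η‖ ≤ R₀ → χ η = 1
  eq_zero : ∀ η, R₀ + 1 ≤ ‖η‖ → χ η = 0

/-- Low-frequency part of the kernel with Fourier transform `M`: the matrix-valued function whose
Fourier transform is `χ M`, that is `x ↦ (2π)⁻² ∫ exp(-i η·x) χ(η) M(η) dη`, entry by entry. -/
def lowFreqPart (χ : Plane → ℝ) (M : Plane → Matrix StateIdx StateIdx ℂ) (x : Plane) :
    Matrix StateIdx StateIdx ℂ :=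
  Matrix.of fun i j =>
    ((2 * Real.pi : ℝ) : ℂ)⁻¹ ^ 2 *
      ∫ η : Plane, Complex.exp (-(Complex.I * (inner ℝ η x : ℝ))) * ((χ η : ℂ) * M η i j)

/-- `S_∥^{LF}(t)`. -/
def curlFreeLF (c ν : ℝ) (χ : Plane → ℝ) (t : ℝ) : Plane → Matrix StateIdx StateIdx ℂ :=
  lowFreqPart χ (curlFreeSymbol c ν t)

/-- `S̃_∥^{LF}(t)`. -/
def artificialLF (c ν : ℝ) (χ : Plane → ℝ) (t : ℝ) : Plane → Matrix StateIdx StateIdx ℂ :=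
  lowFreqPart χ (artificialSymbol c ν t)

/-- The partial derivative `∂ⱼ f`. -/
def partialDeriv (j : Fin 2) (f : Plane → ℂ) : Plane → ℂ :=
  fun x => fderiv ℝ f x (EuclideanSpace.single j 1)

/-- `D^σ f = ∂₁^{σ₁} ∂₂^{σ₂} f` for a multi-index `σ`. -/
def multiDeriv (σ : Fin 2 → ℕ) (f : Plane → ℂ) : Plane → ℂ :=
  (partialDeriv 0)^[σ 0] ((partialDeriv 1)^[σ 1] f)

/-- The length `|σ|` of a multi-index. -/
def multiLength (σ : Fin 2 → ℕ) : ℕ := ∑ j, σ j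

end ViscousFlow

end

/-!
The difference of the two low-frequency kernels is estimated from its Fourier transform, in `L²`, in
`L∞`, and in a weighted `L²` space that controls `L¹`; the other exponents follow by interpolation.

**Smooth form of the symbols.** Let `Φₖ` be the `k`-th derivative of the entire function
`z ↦ cos √z` (`cosSqrt`) and `qₛ = c²|η|² - s (ν²/4)|η|⁴` (`freqSq`). Off a null set, both symbols are
combinations of `exp (-ν|η|²t/2) Φ₀(qₛ t²)` and `t exp (-ν|η|²t/2) Φ₁(qₛ t²)`, with `s = 1` for the
curl-free system and `s = 0` for the artificial viscosity system (`regularSymbol`). In this form the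
removable singularities have disappeared.

**Pointwise bounds.** By the Bessel-type equation `z Φₖ₊₂ + (k + 1/2) Φₖ₊₁ + Φₖ/4 = 0`
(`cosSqrt_ode`), `Φₖ(z)` decays like `z^(-k/2)` as `z → ∞`, so `(|η|t)ᵏ Φₖ(qₛ t²)` is bounded at low
frequencies. Where `qₛ < 0`, the growth of `Φₖ` is beaten by the damping, because
`ν|η|²/2 - √(-qₛ) ≥ c²/ν`. Hence a multiplier `|η|ᵖ t^q exp (-ν|η|²t/2) Φₖ(qₛ t²)` is at most
`t^(q - (p + j)/2) exp (-b|η|²t)` for all `j ≤ min k p` (`gaussBound_monomial`). Differentiating in `s`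
brings down the factor `|η|⁴t²` and replaces `Φₖ` by `Φₖ₊₁`, which is a gain of `t^(-1/2)` for the
difference of the symbols.

**The weight.** The kernels concentrate near the light cone `|x| = c t`, at distance `√t`. Multiplication
by `|x|² - c²t²` is `-(Δ + c²t²)` on the Fourier side. Applied to `B(η) Φₖ(qₛ t²)`, the terms of order
`t²` cancel by the Bessel-type equation (`waveForm_eq`), so the operator costs `t^(3/2)` only, as if
`|x|` were `c t + O(√t)`. Since `∫ (1 + ((|x|² - c²t²)/t^(3/2))²)⁻¹ dx = O(t^(3/2))`
(`integral_inv_coneWeight_le`), the Cauchy-Schwarz inequality bounds the `L¹` norm by `t^(3/4)` times the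
`L²` rate (`ConeLocalized.exists_norm_le`). No logarithm appears for the difference of the kernels, which
is why the loss `θ` in the range `p ≤ 2` is not needed.
-/

namespace ViscousFlow

open Filter Topology MeasureTheory

/-! ### The entire function `z ↦ cos √z` and its derivatives -/

/-- Taylor coefficient of `zⁿ` in the `k`-th derivative of `∑ (-1)ⁿ zⁿ / (2n)!`. -/
noncomputable def cosSqrtCoeff (k n : ℕ) : ℝ :=
  (-1) ^ (n + k) * (n + k).factorial / (n.factorial * (2 * (n + k)).factorial)

/-- The `k`-th derivative of the entire function `z ↦ cos √z`, restricted to real arguments; for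
`z < 0` it continues as a derivative of `cosh √(-z)`. -/
noncomputable def cosSqrt (k : ℕ) (z : ℝ) : ℝ := ∑' n, cosSqrtCoeff k n * z ^ n

theorem succ_mul_cosSqrtCoeff_succ (k n : ℕ) :
    ((n : ℝ) + 1) * cosSqrtCoeff k (n + 1) = cosSqrtCoeff (k + 1) n := by
  have h : n + 1 + k = n + (k + 1) := by ring
  rw [cosSqrtCoeff, cosSqrtCoeff, h, Nat.factorial_succ n]
  push_cast
  have := Nat.factorial_ne_zero n
  field_simp

theorem cosSqrtCoeff_succ_left (k n : ℕ) :
    ((n : ℝ) + k + 1 / 2) * cosSqrtCoeff (k + 1) n = -(1 / 4) * cosSqrtCoeff k n := by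
  have h : n + (k + 1) = n + k + 1 := by ring
  have h2 : 2 * (n + k + 1) = 2 * (n + k) + 1 + 1 := by ring
  rw [cosSqrtCoeff, cosSqrtCoeff, h, h2, Nat.factorial_succ (n + k),
    Nat.factorial_succ (2 * (n + k) + 1), Nat.factorial_succ (2 * (n + k)), pow_succ]
  have := Nat.factorial_ne_zero n
  have := Nat.factorial_ne_zero (n + k)
  have := Nat.factorial_ne_zero (2 * (n + k))
  push_cast
  field_simp
  ring

theorem abs_cosSqrtCoeff_succ_le (k n : ℕ) : |cosSqrtCoeff (k + 1) n| ≤ |cosSqrtCoeff k n| := by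
  have h := congrArg abs (cosSqrtCoeff_succ_left k n)
  rw [abs_mul, abs_mul, abs_of_pos (by positivity : (0 : ℝ) < (n : ℝ) + k + 1 / 2)] at h
  norm_num at h
  have h1 : (0 : ℝ) ≤ n := by positivity
  have h2 : (0 : ℝ) ≤ k := by positivity
  nlinarith [abs_nonneg (cosSqrtCoeff (k + 1) n), mul_nonneg h1 (abs_nonneg (cosSqrtCoeff (k + 1) n)),
    mul_nonneg h2 (abs_nonneg (cosSqrtCoeff (k + 1) n)), abs_nonneg (cosSqrtCoeff k n)]

theorem abs_cosSqrtCoeff_le (k n : ℕ) : |cosSqrtCoeff k n| ≤ 1 / ((2 * n).factorial : ℝ) := by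
  induction k with
  | zero =>
    have := Nat.factorial_ne_zero n
    have := Nat.factorial_ne_zero (2 * n)
    simp only [cosSqrtCoeff, add_zero]
    rw [abs_div, abs_mul, abs_pow, abs_neg, abs_one, one_pow, one_mul, abs_mul, Nat.abs_cast,
      Nat.abs_cast]
    apply le_of_eq
    field_simp
  | succ k ih => exact (abs_cosSqrtCoeff_succ_le k n).trans ih

theorem hasSum_cosh_sqrt {x : ℝ} (hx : 0 ≤ x) :
    HasSum (fun n : ℕ => 1 / ((2 * n).factorial : ℝ) * x ^ n) (Real.cosh (√x)) := by
  refine (Real.hasSum_cosh (√x)).congr_fun ?_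
  intro n
  rw [pow_mul, Real.sq_sqrt hx]
  ring

theorem norm_cosSqrt_term_le (k n : ℕ) (z : ℝ) :
    ‖cosSqrtCoeff k n * z ^ n‖ ≤ 1 / ((2 * n).factorial : ℝ) * |z| ^ n := by
  rw [norm_mul, norm_pow, Real.norm_eq_abs, Real.norm_eq_abs]
  gcongr
  exact abs_cosSqrtCoeff_le k n

theorem summable_cosSqrt (k : ℕ) (z : ℝ) : Summable fun n => cosSqrtCoeff k n * z ^ n :=
  Summable.of_norm_bounded (hasSum_cosh_sqrt (abs_nonneg z)).summable
    fun n => norm_cosSqrt_term_le k n z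

theorem abs_cosSqrt_le_cosh (k : ℕ) (z : ℝ) : |cosSqrt k z| ≤ Real.cosh (√|z|) := by
  rw [← (hasSum_cosh_sqrt (abs_nonneg z)).tsum_eq]
  exact tsum_of_norm_bounded (hasSum_cosh_sqrt (abs_nonneg z)).summable.hasSum
    fun n => norm_cosSqrt_term_le k n z

theorem hasDerivAt_cosSqrt (k : ℕ) (z : ℝ) : HasDerivAt (cosSqrt k) (cosSqrt (k + 1) z) z := by
  have key : HasDerivAt (fun w => ∑' n, cosSqrtCoeff k n * w ^ n)
      (∑' n : ℕ, cosSqrtCoeff k n * (n * z ^ (n - 1))) z := by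
    have hu : Summable fun n : ℕ => |cosSqrtCoeff k n| * (n * (|z| + 1) ^ (n - 1)) := by
      rw [← summable_nat_add_iff 1]
      refine (hasSum_cosh_sqrt (by positivity : 0 ≤ |z| + 1)).summable.of_nonneg_of_le
        (fun n => by positivity) fun n => ?_
      have h := succ_mul_cosSqrtCoeff_succ k n
      have h1 := abs_cosSqrtCoeff_le (k + 1) n
      rw [← h, abs_mul, abs_of_pos (by positivity : (0 : ℝ) < (n : ℝ) + 1)] at h1
      rw [Nat.add_sub_cancel, ← mul_assoc, mul_comm |cosSqrtCoeff k (n + 1)|]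
      push_cast
      gcongr
    refine hasDerivAt_tsum_of_isPreconnected (t := Metric.ball 0 (|z| + 1)) hu Metric.isOpen_ball
      (convex_ball 0 (|z| + 1)).isPreconnected
      (fun n y _ => (hasDerivAt_pow n y).const_mul (cosSqrtCoeff k n)) ?_
      (y₀ := z) (by simp) (summable_cosSqrt k z) (by simp)
    intro n y hy
    rw [mem_ball_zero_iff] at hy
    rw [norm_mul, norm_mul, norm_pow, Real.norm_eq_abs, Real.norm_natCast]
    gcongr
  refine HasDerivAt.congr_deriv key ?_
  have hs : Summable fun n : ℕ => cosSqrtCoeff k n * (n * z ^ (n - 1)) := by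
    rw [← summable_nat_add_iff 1]
    refine (summable_cosSqrt (k + 1) z).congr fun n => ?_
    rw [← succ_mul_cosSqrtCoeff_succ, Nat.add_sub_cancel]
    push_cast
    ring
  rw [hs.tsum_eq_zero_add, cosSqrt]
  simp only [Nat.cast_zero, zero_mul, mul_zero, zero_add, Nat.add_sub_cancel]
  refine tsum_congr fun n => ?_
  rw [← succ_mul_cosSqrtCoeff_succ]
  push_cast
  ring

theorem contDiff_cosSqrt (k : ℕ) : ContDiff ℝ ∞ (cosSqrt k) := by
  refine contDiff_infty.2 fun n => ?_
  induction n generalizing k with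
  | zero =>
    exact contDiff_zero.2
      (continuous_iff_continuousAt.2 fun z => (hasDerivAt_cosSqrt k z).continuousAt)
  | succ n ih =>
    rw [Nat.cast_succ]
    refine contDiff_succ_iff_deriv.2
      ⟨fun z => (hasDerivAt_cosSqrt k z).differentiableAt, by simp, ?_⟩
    have h : deriv (cosSqrt k) = cosSqrt (k + 1) := funext fun z => (hasDerivAt_cosSqrt k z).deriv
    rw [h]
    exact ih (k + 1)

/-- The Bessel-type equation `z Φₖ₊₂ + (k + 1/2) Φₖ₊₁ + Φₖ / 4 = 0` of the derivatives `Φₖ` of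
`cos √z`. -/
theorem cosSqrt_ode (k : ℕ) (z : ℝ) :
    z * cosSqrt (k + 2) z = -(k + 1 / 2) * cosSqrt (k + 1) z - 1 / 4 * cosSqrt k z := by
  have h2 : z * cosSqrt (k + 2) z = ∑' n : ℕ, (n : ℝ) * cosSqrtCoeff (k + 1) n * z ^ n := by
    have hs : Summable fun n : ℕ => (n : ℝ) * cosSqrtCoeff (k + 1) n * z ^ n := by
      rw [← summable_nat_add_iff 1]
      refine ((summable_cosSqrt (k + 2) z).mul_left z).congr fun n => ?_
      rw [← succ_mul_cosSqrtCoeff_succ]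
      push_cast
      ring
    rw [hs.tsum_eq_zero_add, cosSqrt, ← tsum_mul_left]
    simp only [Nat.cast_zero, zero_mul, zero_add]
    refine tsum_congr fun n => ?_
    rw [← succ_mul_cosSqrtCoeff_succ (k + 1)]
    push_cast
    ring
  rw [h2, cosSqrt, cosSqrt, ← tsum_mul_left, ← tsum_mul_left,
    ← ((summable_cosSqrt (k + 1) z).mul_left _).tsum_sub ((summable_cosSqrt k z).mul_left _)]
  refine tsum_congr fun n => ?_
  have := cosSqrtCoeff_succ_left k n
  linear_combination z ^ n * this

theorem cosh_eq_cosSqrt {ζ : ℂ} {x : ℝ} (h : ζ ^ 2 = -x) : Complex.cosh ζ = cosSqrt 0 x := by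
  have h1 := (Complex.hasSum_ofReal.2 (summable_cosSqrt 0 x).hasSum)
  refine (Complex.hasSum_cosh ζ).unique (h1.congr_fun fun n => ?_)
  have := Nat.factorial_ne_zero n
  have := Nat.factorial_ne_zero (2 * n)
  rw [pow_mul, h, neg_pow, cosSqrtCoeff]
  push_cast
  simp only [add_zero]
  field_simp

theorem sinh_eq_cosSqrt {ζ : ℂ} {x : ℝ} (h : ζ ^ 2 = -x) :
    Complex.sinh ζ = -2 * ζ * cosSqrt 1 x := by
  have h1 := (Complex.hasSum_ofReal.2 (summable_cosSqrt 1 x).hasSum).mul_left (-2 * ζ)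
  refine (Complex.hasSum_sinh ζ).unique (h1.congr_fun fun n => ?_)
  have h2 : 2 * (n + 1) = 2 * n + 1 + 1 := by ring
  have := Nat.factorial_ne_zero n
  have := Nat.factorial_ne_zero (2 * n + 1)
  rw [pow_succ, pow_mul, h, neg_pow, cosSqrtCoeff, h2, Nat.factorial_succ (2 * n + 1),
    Nat.factorial_succ n, pow_succ]
  have h3 : ((n : ℂ) + 1) ≠ 0 := by exact_mod_cast Nat.succ_ne_zero n
  have h4 : (2 * (n : ℂ) + 1 + 1) ≠ 0 := by exact_mod_cast Nat.succ_ne_zero (2 * n + 1)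
  push_cast
  field_simp
  ring

theorem cosSqrt_zero_sq (x : ℝ) : cosSqrt 0 (x ^ 2) = Real.cos x := by
  have h := cosh_eq_cosSqrt (ζ := x * Complex.I) (x := x ^ 2) (by
    rw [mul_pow, Complex.I_sq]; push_cast; ring)
  rw [Complex.cosh_mul_I] at h
  exact_mod_cast h.symm

theorem mul_cosSqrt_one_sq (x : ℝ) : x * cosSqrt 1 (x ^ 2) = -(1 / 2) * Real.sin x := by
  have h := sinh_eq_cosSqrt (ζ := x * Complex.I) (x := x ^ 2) (by
    rw [mul_pow, Complex.I_sq]; push_cast; ring)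
  rw [Complex.sinh_mul_I] at h
  have h2 : (Real.sin x : ℂ) = -2 * x * cosSqrt 1 (x ^ 2) := by
    apply mul_right_cancel₀ Complex.I_ne_zero
    rw [Complex.ofReal_sin, h]
    ring
  have h3 : Real.sin x = -2 * x * cosSqrt 1 (x ^ 2) := by exact_mod_cast h2
  rw [h3]
  ring

/-- Decay of the derivatives of `cos √z` on the positive half-line, at the order given by the
differential equation: `|Φₖ(x²)| ≤ C x⁻ʲ` for `j ≤ k`. -/
theorem exists_pow_mul_cosSqrt_le (k : ℕ) :
    ∃ C : ℝ, 0 < C ∧ ∀ j ≤ k, ∀ x : ℝ, 0 ≤ x → x ^ j * |cosSqrt k (x ^ 2)| ≤ C := by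
  have main : ∃ C : ℝ, 0 < C ∧ ∀ x : ℝ, 1 ≤ x → x ^ k * |cosSqrt k (x ^ 2)| ≤ C := by
    induction k using Nat.twoStepInduction with
    | zero =>
      refine ⟨1, one_pos, fun x _ => ?_⟩
      rw [cosSqrt_zero_sq]
      simpa using Real.abs_cos_le_one x
    | one =>
      refine ⟨1, one_pos, fun x hx => ?_⟩
      have h := congrArg abs (mul_cosSqrt_one_sq x)
      rw [abs_mul, abs_mul, abs_of_nonneg (by linarith : 0 ≤ x)] at h
      rw [pow_one, h]
      have := Real.abs_sin_le_one x
      norm_num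
      linarith
    | more k ih0 ih1 =>
      obtain ⟨C0, hC0, h0⟩ := ih0
      obtain ⟨C1, hC1, h1⟩ := ih1
      refine ⟨(k + 1 / 2) * C1 + 1 / 4 * C0, by positivity, fun x hx => ?_⟩
      have hx0 : 0 ≤ x := by linarith
      have e : x ^ (k + 2) * |cosSqrt (k + 2) (x ^ 2)| =
          x ^ k * |x ^ 2 * cosSqrt (k + 2) (x ^ 2)| := by
        rw [abs_mul, abs_of_nonneg (by positivity : 0 ≤ x ^ 2)]
        ring
      rw [e, cosSqrt_ode]
      have hk : x ^ k ≤ x ^ (k + 1) := pow_le_pow_right₀ hx (Nat.le_succ k)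
      have a1 : x ^ k * |cosSqrt (k + 1) (x ^ 2)| ≤ C1 :=
        (mul_le_mul_of_nonneg_right hk (abs_nonneg _)).trans (h1 x hx)
      calc x ^ k * |-(k + 1 / 2) * cosSqrt (k + 1) (x ^ 2) - 1 / 4 * cosSqrt k (x ^ 2)|
          ≤ x ^ k * ((k + 1 / 2) * |cosSqrt (k + 1) (x ^ 2)| + 1 / 4 * |cosSqrt k (x ^ 2)|) := by
            gcongr
            refine (abs_sub _ _).trans_eq ?_
            rw [abs_mul, abs_mul, abs_neg, abs_of_pos (by positivity : (0 : ℝ) < k + 1 / 2),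
              abs_of_pos (by norm_num : (0 : ℝ) < 1 / 4)]
        _ = (k + 1 / 2) * (x ^ k * |cosSqrt (k + 1) (x ^ 2)|)
              + 1 / 4 * (x ^ k * |cosSqrt k (x ^ 2)|) := by ring
        _ ≤ _ := by gcongr; exact h0 x hx
  obtain ⟨C, hC, h⟩ := main
  refine ⟨C + Real.cosh 1, by positivity, fun j hj x hx => ?_⟩
  rcases le_total 1 x with h1 | h1
  · have := Real.cosh_pos 1
    have := (mul_le_mul_of_nonneg_right (pow_le_pow_right₀ h1 hj)
      (abs_nonneg (cosSqrt k (x ^ 2)))).trans (h x h1)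
    linarith
  · have a : |cosSqrt k (x ^ 2)| ≤ Real.cosh 1 := by
      refine (abs_cosSqrt_le_cosh k (x ^ 2)).trans ?_
      rw [abs_of_nonneg (sq_nonneg x), Real.sqrt_sq hx, Real.cosh_le_cosh, abs_of_nonneg hx, abs_one]
      exact h1
    have b : x ^ j * |cosSqrt k (x ^ 2)| ≤ 1 * Real.cosh 1 := by
      gcongr
      exact pow_le_one₀ hx h1
    linarith

/-! ### Gaussian bounds for the oscillating multipliers -/

/-- The squared frequency `c² y - s (ν²/4) y²` at `y = |η|²`; `s = 0` gives the wave equation, `s = 1`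
the curl-free viscous system. -/
noncomputable def freqSq (c ν s y : ℝ) : ℝ := c ^ 2 * y - s * (ν ^ 2 / 4) * y ^ 2

theorem exists_one_add_pow_le_exp (k : ℕ) {ε : ℝ} (hε : 0 < ε) :
    ∃ C : ℝ, 0 < C ∧ ∀ x : ℝ, 0 ≤ x → (1 + x) ^ k ≤ C * Real.exp (ε * x) := by
  refine ⟨k.factorial / ε ^ k * Real.exp ε, by positivity, fun x hx => ?_⟩
  have h := Real.pow_div_factorial_le_exp (ε * (1 + x)) (by positivity) k
  rw [div_le_iff₀ (by positivity), mul_pow] at h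
  have e : ε * (1 + x) = ε + ε * x := by ring
  rw [e, Real.exp_add] at h
  have h2 : (1 + x) ^ k = ε ^ k * (1 + x) ^ k / ε ^ k := by field_simp
  rw [h2, div_le_iff₀ (by positivity)]
  refine h.trans_eq ?_
  field_simp

/-- Below the frequency `|η| ≤ √2 c/ν` the multiplier oscillates and `r t` is controlled by the phase;
above it the gap between the damping `ν r²/2` and the growth of `cosh` is at least `c²/ν`, which
absorbs every power of `t`. -/
theorem exists_pow_mul_cosSqrt_freqSq_le {c ν R : ℝ} (hc : 0 < c) (hν : 0 < ν) (hR : 0 < R) (k : ℕ) :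
    ∃ C b : ℝ, 0 < C ∧ 0 < b ∧ ∀ j ≤ k, ∀ s ∈ Set.Icc (0 : ℝ) 1, ∀ t : ℝ, 1 ≤ t →
      ∀ r : ℝ, 0 ≤ r → r ≤ R →
        (r * t) ^ j * |cosSqrt k (freqSq c ν s (r ^ 2) * t ^ 2)| * Real.exp (-(ν / 2 * r ^ 2 * t))
          ≤ C * Real.exp (-(b * r ^ 2 * t)) := by
  obtain ⟨C₀, hC₀, h₀⟩ := exists_pow_mul_cosSqrt_le k
  set b₀ : ℝ := min (ν / 2) (c ^ 2 / (ν * R ^ 2)) with hb₀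
  have hb₀pos : 0 < b₀ := by positivity
  set δ : ℝ := 2 * c ^ 2 / ν ^ 2 with hδ
  have hδpos : 0 < δ := by positivity
  obtain ⟨C₁, hC₁, h₁⟩ := exists_one_add_pow_le_exp k
    (show 0 < b₀ * δ / (2 * R) by positivity)
  refine ⟨(1 + 2 / c) ^ k * C₀ + C₁ * (C₀ + 1), b₀ / 2, by positivity, by positivity, ?_⟩
  intro j hj s hs t ht r hr hrR
  have ht0 : 0 < t := by linarith
  have hyt : 0 ≤ r ^ 2 * t := by positivity
  rcases le_or_gt (r ^ 2) δ with hlow | hhigh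
  · have hq : c ^ 2 * r ^ 2 / 2 ≤ freqSq c ν s (r ^ 2) := by
      have h1 : s * (ν ^ 2 / 4) * r ^ 2 ≤ c ^ 2 / 2 := by
        calc s * (ν ^ 2 / 4) * r ^ 2 ≤ 1 * (ν ^ 2 / 4) * δ := by
              gcongr
              exact hs.2
          _ = c ^ 2 / 2 := by rw [hδ]; field_simp; ring
      rw [freqSq]
      nlinarith [sq_nonneg r, mul_le_mul_of_nonneg_right h1 (sq_nonneg r)]
    have hq0 : 0 ≤ freqSq c ν s (r ^ 2) := le_trans (by positivity) hq
    set x : ℝ := √(freqSq c ν s (r ^ 2)) * t with hx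
    have hx0 : 0 ≤ x := by positivity
    have hxsq : freqSq c ν s (r ^ 2) * t ^ 2 = x ^ 2 := by rw [hx, mul_pow, Real.sq_sqrt hq0]
    have hrx : r * t ≤ 2 / c * x := by
      have : r ≤ 2 / c * √(freqSq c ν s (r ^ 2)) := by
        refine le_of_sq_le_sq ?_ (by positivity)
        rw [mul_pow, Real.sq_sqrt hq0, div_pow, div_mul_eq_mul_div, le_div_iff₀ (by positivity)]
        nlinarith [mul_nonneg (sq_nonneg c) (sq_nonneg r)]
      rw [hx, ← mul_assoc]
      gcongr
    rw [hxsq]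
    have e1 : (r * t) ^ j * |cosSqrt k (x ^ 2)| ≤ (1 + 2 / c) ^ k * C₀ := by
      calc (r * t) ^ j * |cosSqrt k (x ^ 2)| ≤ (2 / c * x) ^ j * |cosSqrt k (x ^ 2)| := by gcongr
        _ = (2 / c) ^ j * (x ^ j * |cosSqrt k (x ^ 2)|) := by rw [mul_pow]; ring
        _ ≤ (1 + 2 / c) ^ k * C₀ := by
          gcongr
          · calc (2 / c) ^ j ≤ (1 + 2 / c) ^ j := by gcongr; linarith
              _ ≤ (1 + 2 / c) ^ k :=
                pow_le_pow_right₀ (by have : 0 < 2 / c := by positivity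
                                      linarith) hj
          · exact h₀ j hj x hx0
    have e2 : Real.exp (-(ν / 2 * r ^ 2 * t)) ≤ Real.exp (-(b₀ / 2 * r ^ 2 * t)) := by
      have : b₀ ≤ ν / 2 := min_le_left _ _
      rw [Real.exp_le_exp]
      nlinarith
    calc _ ≤ ((1 + 2 / c) ^ k * C₀) * Real.exp (-(b₀ / 2 * r ^ 2 * t)) := by gcongr
      _ ≤ _ := by
        gcongr
        have : 0 < C₁ * (C₀ + 1) := by positivity
        linarith
  · have e1 : |cosSqrt k (freqSq c ν s (r ^ 2) * t ^ 2)| * Real.exp (-(ν / 2 * r ^ 2 * t))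
        ≤ (C₀ + 1) * Real.exp (-(b₀ * r ^ 2 * t)) := by
      rcases le_or_gt 0 (freqSq c ν s (r ^ 2)) with hq | hq
      · have h2 := h₀ 0 (Nat.zero_le k) (√(freqSq c ν s (r ^ 2)) * t) (by positivity)
        rw [pow_zero, one_mul, mul_pow, Real.sq_sqrt hq] at h2
        have : b₀ ≤ ν / 2 := min_le_left _ _
        gcongr
        linarith
      · have h2 : √|freqSq c ν s (r ^ 2) * t ^ 2| ≤ (ν / 2 * r ^ 2 - c ^ 2 / ν) * t := by
          have hg : 0 ≤ ν / 2 * r ^ 2 - c ^ 2 / ν := by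
            have : ν / 2 * δ = c ^ 2 / ν := by rw [hδ]; field_simp
            nlinarith
          refine Real.sqrt_le_iff.2 ⟨by positivity, ?_⟩
          rw [abs_mul, abs_of_neg hq, abs_of_pos (by positivity : 0 < t ^ 2), mul_pow]
          gcongr
          have e : (ν / 2 * r ^ 2 - c ^ 2 / ν) ^ 2
              = ν ^ 2 / 4 * (r ^ 2) ^ 2 - c ^ 2 * r ^ 2 + (c ^ 2 / ν) ^ 2 := by
            field_simp
            ring
          rw [e, freqSq]
          have : s * (ν ^ 2 / 4) * (r ^ 2) ^ 2 ≤ 1 * (ν ^ 2 / 4) * (r ^ 2) ^ 2 := by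
            gcongr
            exact hs.2
          nlinarith [sq_nonneg (c ^ 2 / ν)]
        have h3 : |cosSqrt k (freqSq c ν s (r ^ 2) * t ^ 2)|
            ≤ Real.exp ((ν / 2 * r ^ 2 - c ^ 2 / ν) * t) := by
          refine (abs_cosSqrt_le_cosh _ _).trans ?_
          have h4 := Real.cosh_eq (√|freqSq c ν s (r ^ 2) * t ^ 2|)
          have h5 : Real.exp (-√|freqSq c ν s (r ^ 2) * t ^ 2|)
              ≤ Real.exp (√|freqSq c ν s (r ^ 2) * t ^ 2|) := by
            rw [Real.exp_le_exp]
            have := Real.sqrt_nonneg |freqSq c ν s (r ^ 2) * t ^ 2|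
            linarith
          have h6 := Real.exp_le_exp.2 h2
          linarith
        calc _ ≤ Real.exp ((ν / 2 * r ^ 2 - c ^ 2 / ν) * t) * Real.exp (-(ν / 2 * r ^ 2 * t)) := by
              gcongr
          _ = Real.exp (-(c ^ 2 / ν * t)) := by rw [← Real.exp_add]; ring_nf
          _ ≤ 1 * Real.exp (-(b₀ * r ^ 2 * t)) := by
            rw [one_mul, Real.exp_le_exp]
            have a1 : b₀ * r ^ 2 ≤ c ^ 2 / ν := by
              calc b₀ * r ^ 2 ≤ c ^ 2 / (ν * R ^ 2) * R ^ 2 := by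
                    gcongr
                    exact min_le_right _ _
                _ = c ^ 2 / ν := by field_simp
            nlinarith
          _ ≤ _ := by gcongr; linarith
    have e2 : (r * t) ^ j ≤ C₁ * Real.exp (b₀ / 2 * r ^ 2 * t) := by
      calc (r * t) ^ j ≤ (1 + R * t) ^ j := by gcongr; nlinarith
        _ ≤ (1 + R * t) ^ k := pow_le_pow_right₀ (by nlinarith [mul_pos hR ht0]) hj
        _ ≤ C₁ * Real.exp (b₀ * δ / (2 * R) * (R * t)) := h₁ _ (by positivity)
        _ ≤ _ := by
          have e : b₀ * δ / (2 * R) * (R * t) = b₀ / 2 * δ * t := by field_simp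
          rw [e]
          gcongr
    calc _ = (r * t) ^ j * (|cosSqrt k (freqSq c ν s (r ^ 2) * t ^ 2)|
            * Real.exp (-(ν / 2 * r ^ 2 * t))) := by ring
      _ ≤ C₁ * Real.exp (b₀ / 2 * r ^ 2 * t) * ((C₀ + 1) * Real.exp (-(b₀ * r ^ 2 * t))) := by
        gcongr
      _ = C₁ * (C₀ + 1) * (Real.exp (b₀ / 2 * r ^ 2 * t) * Real.exp (-(b₀ * r ^ 2 * t))) := by ring
      _ = C₁ * (C₀ + 1) * Real.exp (-(b₀ / 2 * r ^ 2 * t)) := by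
        rw [← Real.exp_add]; ring_nf
      _ ≤ _ := by
        gcongr
        have : 0 < (1 + 2 / c) ^ k * C₀ := by positivity
        linarith

/-- `GaussBound R m G`: on the disc `|η| ≤ R`, uniformly in `s ∈ [0, 1]` and `t ≥ 1`,
`|G s t η| ≤ C tᵐ exp (-b |η|² t)` for some `C, b > 0`. -/
def GaussBound (R m : ℝ) (G : ℝ → ℝ → Plane → ℝ) : Prop :=
  ∃ C b : ℝ, 0 < C ∧ 0 < b ∧ ∀ s ∈ Set.Icc (0 : ℝ) 1, ∀ t : ℝ, 1 ≤ t → ∀ η : Plane, ‖η‖ ≤ R →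
    |G s t η| ≤ C * t ^ m * Real.exp (-(b * ‖η‖ ^ 2 * t))

namespace GaussBound

variable {R m m' : ℝ} {G H : ℝ → ℝ → Plane → ℝ}

theorem of_abs_le (hH : GaussBound R m H) {K : ℝ}
    (h : ∀ s ∈ Set.Icc (0 : ℝ) 1, ∀ t : ℝ, 1 ≤ t → ∀ η : Plane, ‖η‖ ≤ R →
      |G s t η| ≤ K * |H s t η|) : GaussBound R m G := by
  obtain ⟨C, b, hC, hb, hB⟩ := hH
  refine ⟨(|K| + 1) * C, b, by positivity, hb, fun s hs t ht η hη => ?_⟩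
  calc |G s t η| ≤ K * |H s t η| := h s hs t ht η hη
    _ ≤ (|K| + 1) * |H s t η| := by gcongr; linarith [le_abs_self K]
    _ ≤ (|K| + 1) * (C * t ^ m * Real.exp (-(b * ‖η‖ ^ 2 * t))) := by
      gcongr
      exact hB s hs t ht η hη
    _ = _ := by ring

theorem congr (hH : GaussBound R m H)
    (h : ∀ s ∈ Set.Icc (0 : ℝ) 1, ∀ t : ℝ, 1 ≤ t → ∀ η : Plane, ‖η‖ ≤ R → G s t η = H s t η) :
    GaussBound R m G :=
  hH.of_abs_le (K := 1) fun s hs t ht η hη => by rw [h s hs t ht η hη, one_mul]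

theorem mono (hG : GaussBound R m G) (h : m ≤ m') : GaussBound R m' G := by
  obtain ⟨C, b, hC, hb, hB⟩ := hG
  refine ⟨C, b, hC, hb, fun s hs t ht η hη => (hB s hs t ht η hη).trans ?_⟩
  gcongr

theorem add (hG : GaussBound R m G) (hH : GaussBound R m H) :
    GaussBound R m fun s t η => G s t η + H s t η := by
  obtain ⟨C, b, hC, hb, hB⟩ := hG
  obtain ⟨C', b', hC', hb', hB'⟩ := hH
  refine ⟨C + C', min b b', by positivity, by positivity, fun s hs t ht η hη => ?_⟩
  have ht0 : 0 < t := by linarith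
  calc |G s t η + H s t η| ≤ |G s t η| + |H s t η| := abs_add_le _ _
    _ ≤ C * t ^ m * Real.exp (-(b * ‖η‖ ^ 2 * t)) + C' * t ^ m * Real.exp (-(b' * ‖η‖ ^ 2 * t)) :=
      add_le_add (hB s hs t ht η hη) (hB' s hs t ht η hη)
    _ ≤ C * t ^ m * Real.exp (-(min b b' * ‖η‖ ^ 2 * t))
        + C' * t ^ m * Real.exp (-(min b b' * ‖η‖ ^ 2 * t)) := by
      gcongr
      · exact min_le_left _ _
      · exact min_le_right _ _
    _ = _ := by ring

theorem const_mul (hG : GaussBound R m G) (a : ℝ) : GaussBound R m fun s t η => a * G s t η :=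
  hG.of_abs_le (K := |a|) fun s _ t _ η _ => by rw [abs_mul]

end GaussBound

/-- On Gaussian scales `|η| ~ t^(-1/2)`, and each of the first `l` powers of `|η| t` is absorbed by
the decay of `Φₗ`. -/
theorem gaussBound_monomial {c ν R : ℝ} (hc : 0 < c) (hν : 0 < ν) (hR : 0 < R) {l j p : ℕ} (q : ℕ)
    (hjl : j ≤ l) (hjp : j ≤ p) :
    GaussBound R (q - (p + j) / 2) fun s t η =>
      ‖η‖ ^ p * t ^ q * (Real.exp (-(ν / 2 * ‖η‖ ^ 2 * t)) *
        cosSqrt l (freqSq c ν s (‖η‖ ^ 2) * t ^ 2)) := by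
  obtain ⟨C₀, b, hC₀, hb, h₀⟩ := exists_pow_mul_cosSqrt_freqSq_le hc hν hR l
  obtain ⟨C₁, hC₁, h₁⟩ := exists_one_add_pow_le_exp (p - j) (show 0 < b / 2 by positivity)
  refine ⟨C₀ * C₁, b / 2, by positivity, by positivity, fun s hs t ht η hη => ?_⟩
  have ht0 : 0 < t := by linarith
  set r := ‖η‖ with hr
  have hr0 : 0 ≤ r := norm_nonneg η
  have hpow : r ^ p * t ^ q = (r * t) ^ j * ((r * √t) ^ (p - j) * t ^ ((q : ℝ) - (p + j) / 2)) := by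
    have e1 : (√t) ^ (p - j) * t ^ ((q : ℝ) - (p + j) / 2) * t ^ j = t ^ q := by
      rw [Real.sqrt_eq_rpow, ← Real.rpow_natCast, ← Real.rpow_natCast, ← Real.rpow_natCast,
        ← Real.rpow_mul ht0.le, ← Real.rpow_add ht0, ← Real.rpow_add ht0]
      congr 1
      rw [Nat.cast_sub hjp]
      ring
    have e2 : r ^ p = r ^ j * r ^ (p - j) := by rw [← pow_add, Nat.add_sub_cancel' hjp]
    rw [← e1, e2]
    ring
  have hgrow : (r * √t) ^ (p - j) ≤ C₁ * Real.exp (b / 2 * r ^ 2 * t) := by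
    have e : (r * √t) ^ 2 = r ^ 2 * t := by rw [mul_pow, Real.sq_sqrt ht0.le]
    calc (r * √t) ^ (p - j) ≤ (1 + r ^ 2 * t) ^ (p - j) := by
          gcongr
          rw [← e]
          nlinarith [sq_nonneg (r * √t - 1)]
      _ ≤ C₁ * Real.exp (b / 2 * (r ^ 2 * t)) := h₁ _ (by positivity)
      _ = _ := by rw [mul_assoc (b / 2)]
  have hmain := h₀ j hjl s hs t ht r hr0 hη
  set X := cosSqrt l (freqSq c ν s (r ^ 2) * t ^ 2)
  change |r ^ p * t ^ q * (Real.exp (-(ν / 2 * r ^ 2 * t)) * X)| ≤ _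
  rw [abs_mul, abs_mul (Real.exp _), abs_of_nonneg (by positivity : 0 ≤ r ^ p * t ^ q),
    abs_of_pos (Real.exp_pos _), hpow]
  calc _ = ((r * t) ^ j * |X| * Real.exp (-(ν / 2 * r ^ 2 * t))) *
        ((r * √t) ^ (p - j) * t ^ ((q : ℝ) - (p + j) / 2)) := by ring
    _ ≤ (C₀ * Real.exp (-(b * r ^ 2 * t))) *
        (C₁ * Real.exp (b / 2 * r ^ 2 * t) * t ^ ((q : ℝ) - (p + j) / 2)) := by gcongr
    _ = C₀ * C₁ * t ^ ((q : ℝ) - (p + j) / 2) *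
        (Real.exp (-(b * r ^ 2 * t)) * Real.exp (b / 2 * r ^ 2 * t)) := by ring
    _ = _ := by rw [← Real.exp_add]; ring_nf

/-! ### The operator `Δ + c²t²` on the oscillating multipliers -/

/-- The damped oscillation `tⁿ exp (-ν y t / 2) Φₖ (q t²)` as a function of `y = |η|²`, where `Φₖ` is
`cosSqrt k` and `q` is `freqSq c ν s y`. -/
noncomputable def dampedCos (c ν : ℝ) (n k : ℕ) (s t y : ℝ) : ℝ :=
  t ^ n * (Real.exp (-(ν / 2 * y * t)) * cosSqrt k (freqSq c ν s y * t ^ 2))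

/-- The derivative of `dampedCos` in `y`. -/
noncomputable def dampedCosDeriv (c ν : ℝ) (n k : ℕ) (s t y : ℝ) : ℝ :=
  -(ν / 2) * dampedCos c ν (n + 1) k s t y
    + (c ^ 2 - s * (ν ^ 2 / 2) * y) * dampedCos c ν (n + 2) (k + 1) s t y

/-- The second derivative of `dampedCos` in `y`. -/
noncomputable def dampedCosDeriv₂ (c ν : ℝ) (n k : ℕ) (s t y : ℝ) : ℝ :=
  -(ν / 2) * dampedCosDeriv c ν (n + 1) k s t y
    + (-(s * (ν ^ 2 / 2)) * dampedCos c ν (n + 2) (k + 1) s t y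
      + (c ^ 2 - s * (ν ^ 2 / 2) * y) * dampedCosDeriv c ν (n + 2) (k + 1) s t y)

theorem hasDerivAt_freqSq (c ν s y : ℝ) :
    HasDerivAt (freqSq c ν s) (c ^ 2 - s * (ν ^ 2 / 2) * y) y := by
  have h := ((hasDerivAt_id y).const_mul (c ^ 2)).sub
    ((hasDerivAt_pow 2 y).const_mul (s * (ν ^ 2 / 4)))
  refine HasDerivAt.congr_deriv h ?_
  push_cast
  ring

theorem hasDerivAt_dampedCos (c ν : ℝ) (n k : ℕ) (s t y : ℝ) :
    HasDerivAt (dampedCos c ν n k s t) (dampedCosDeriv c ν n k s t y) y := by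
  have he : HasDerivAt (fun y : ℝ => Real.exp (-(ν / 2 * y * t)))
      (Real.exp (-(ν / 2 * y * t)) * -(ν / 2 * 1 * t)) y :=
    ((((hasDerivAt_id y).const_mul (ν / 2)).mul_const t).neg).exp
  have hk := (hasDerivAt_cosSqrt k (freqSq c ν s y * t ^ 2)).comp y
    ((hasDerivAt_freqSq c ν s y).mul_const (t ^ 2))
  refine HasDerivAt.congr_deriv ((he.mul hk).const_mul (t ^ n)) ?_
  simp only [dampedCosDeriv, dampedCos, Function.comp]
  ring

theorem hasDerivAt_dampedCosDeriv (c ν : ℝ) (n k : ℕ) (s t y : ℝ) :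
    HasDerivAt (dampedCosDeriv c ν n k s t) (dampedCosDeriv₂ c ν n k s t y) y := by
  have hq : HasDerivAt (fun y : ℝ => c ^ 2 - s * (ν ^ 2 / 2) * y) (-(s * (ν ^ 2 / 2))) y := by
    simpa using ((hasDerivAt_id y).const_mul (s * (ν ^ 2 / 2))).const_sub (c ^ 2)
  exact ((hasDerivAt_dampedCos c ν (n + 1) k s t y).const_mul (-(ν / 2))).add
    (hq.mul (hasDerivAt_dampedCos c ν (n + 2) (k + 1) s t y))

theorem contDiff_dampedCos (c ν : ℝ) (n k : ℕ) (s t : ℝ) : ContDiff ℝ ∞ (dampedCos c ν n k s t) := by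
  unfold dampedCos freqSq
  exact contDiff_const.mul ((by fun_prop : ContDiff ℝ ∞ fun y : ℝ => Real.exp (-(ν / 2 * y * t))).mul
    ((contDiff_cosSqrt k).comp (by fun_prop)))

theorem hasDerivAt_dampedCos_param (c ν : ℝ) (n k : ℕ) (s t y : ℝ) :
    HasDerivAt (fun s => dampedCos c ν n k s t y)
      (-(ν ^ 2 / 4) * y ^ 2 * dampedCos c ν (n + 2) (k + 1) s t y) s := by
  have hq : HasDerivAt (fun s : ℝ => freqSq c ν s y * t ^ 2)
      (-(ν ^ 2 / 4 * y ^ 2) * t ^ 2) s := by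
    have h := ((((hasDerivAt_id s).mul_const (ν ^ 2 / 4)).mul_const (y ^ 2)).const_sub
      (c ^ 2 * y)).mul_const (t ^ 2)
    refine HasDerivAt.congr_deriv h ?_
    ring
  have hk := (hasDerivAt_cosSqrt k (freqSq c ν s y * t ^ 2)).comp s hq
  refine HasDerivAt.congr_deriv
    ((hk.const_mul (Real.exp (-(ν / 2 * y * t)))).const_mul (t ^ n)) ?_
  simp only [dampedCos]
  ring

/-- The value of `(Δ + c²t²) (B · F(|η|²))` for `F = dampedCos c ν n k s t`, in terms of `y = |η|²` and
the values `b₀ = B`, `b₁ = η·∇B`, `b₂ = ΔB`. -/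
noncomputable def waveForm (c ν : ℝ) (n k : ℕ) (s t y b₀ b₁ b₂ : ℝ) : ℝ :=
  (b₂ + c ^ 2 * t ^ 2 * b₀) * dampedCos c ν n k s t y + 4 * b₁ * dampedCosDeriv c ν n k s t y
    + b₀ * (4 * dampedCosDeriv c ν n k s t y + 4 * y * dampedCosDeriv₂ c ν n k s t y)

/-- The terms of order `t²` in `Δ + c²t²` cancel by the differential equation of `Φₖ`, because
`y q'(y)² - c² q(y)` is divisible by `y²`. -/
theorem waveForm_eq (c ν : ℝ) (n k : ℕ) (s t y b₀ b₁ b₂ : ℝ) :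
    waveForm c ν n k s t y b₀ b₁ b₂ =
      (b₂ * dampedCos c ν n k s t y
      + (-(2 * ν) * b₁ + -(2 * ν) * b₀) * dampedCos c ν (n + 1) k s t y)
      + (4 * (c ^ 2 - s * (ν ^ 2 / 2) * y) * b₁ + (4 * (c ^ 2 - s * (ν ^ 2 / 2) * y)
          - 2 * ν ^ 2 * s * y - (4 * k + 2) * c ^ 2) * b₀) * dampedCos c ν (n + 2) (k + 1) s t y
      + (ν ^ 2 * y * b₀) * dampedCos c ν (n + 2) k s t y
      + (-(4 * ν) * y * (c ^ 2 - s * (ν ^ 2 / 2) * y) * b₀) * dampedCos c ν (n + 3) (k + 1) s t y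
      + (s * ν ^ 2 * (s * ν ^ 2 * y - 3 * c ^ 2) * y ^ 2 * b₀)
          * dampedCos c ν (n + 4) (k + 2) s t y := by
  have h := cosSqrt_ode k (freqSq c ν s y * t ^ 2)
  simp only [waveForm, dampedCosDeriv₂, dampedCosDeriv, dampedCos]
  generalize Real.exp (-(ν / 2 * y * t)) = e
  simp only [freqSq] at h ⊢
  generalize cosSqrt k ((c ^ 2 * y - s * (ν ^ 2 / 4) * y ^ 2) * t ^ 2) = f₀ at h ⊢
  generalize cosSqrt (k + 2) ((c ^ 2 * y - s * (ν ^ 2 / 4) * y ^ 2) * t ^ 2) = f₂ at h ⊢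
  generalize cosSqrt (k + 1) ((c ^ 2 * y - s * (ν ^ 2 / 4) * y ^ 2) * t ^ 2) = f₁ at h ⊢
  linear_combination (4 * c ^ 2 * b₀ * t ^ (n + 2) * e) * h

theorem hasDerivAt_waveForm_param (c ν : ℝ) (n k : ℕ) (s t y b₀ b₁ b₂ : ℝ) :
    HasDerivAt (fun s => waveForm c ν n k s t y b₀ b₁ b₂)
      (waveForm c ν (n + 2) (k + 1) s t y (-(ν ^ 2 / 4) * (y ^ 2 * b₀))
        (-(ν ^ 2 / 4) * (4 * y ^ 2 * b₀ + y ^ 2 * b₁))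
        (-(ν ^ 2 / 4) * (y ^ 2 * b₂ + 8 * y * b₁ + 16 * y * b₀))) s := by
  have hq : HasDerivAt (fun s : ℝ => c ^ 2 - s * (ν ^ 2 / 2) * y) (-(ν ^ 2 / 2 * y)) s := by
    simpa using (((hasDerivAt_id s).mul_const (ν ^ 2 / 2)).mul_const y).const_sub (c ^ 2)
  have hs : HasDerivAt (fun s : ℝ => -(s * (ν ^ 2 / 2))) (-(ν ^ 2 / 2)) s := by
    simpa using ((hasDerivAt_id s).mul_const (ν ^ 2 / 2)).fun_neg
  have hd := fun n k => hasDerivAt_dampedCos_param c ν n k s t y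
  have hd1 := fun n k => ((hd (n + 1) k).const_mul (-(ν / 2))).add (hq.mul (hd (n + 2) (k + 1)))
  have hd2 := ((hd1 (n + 1) k).const_mul (-(ν / 2))).add
    ((hs.mul (hd (n + 2) (k + 1))).add (hq.mul (hd1 (n + 2) (k + 1))))
  refine HasDerivAt.congr_deriv (((hd n k).const_mul (b₂ + c ^ 2 * t ^ 2 * b₀)).add
    ((hd1 n k).const_mul (4 * b₁)) |>.add
    ((((hd1 n k).const_mul 4).add (hd2.const_mul (4 * y))).const_mul b₀)) ?_
  simp only [waveForm, dampedCosDeriv₂, dampedCosDeriv, dampedCos, Pi.add_apply, Pi.mul_apply]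
  ring

/-- `CoeffBound R p w`: `|w s η| ≤ K |η|ᵖ` on the disc `|η| ≤ R`, uniformly in `s ∈ [0, 1]`. -/
def CoeffBound (R : ℝ) (p : ℕ) (w : ℝ → Plane → ℝ) : Prop :=
  ∃ K : ℝ, 0 ≤ K ∧ ∀ s ∈ Set.Icc (0 : ℝ) 1, ∀ η : Plane, ‖η‖ ≤ R → |w s η| ≤ K * ‖η‖ ^ p

namespace CoeffBound

variable {R : ℝ} {p p' : ℕ} {w w' : ℝ → Plane → ℝ}

theorem const (a : ℝ) : CoeffBound R 0 fun _ _ => a :=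
  ⟨|a|, abs_nonneg a, fun _ _ _ _ => by simp⟩

theorem param : CoeffBound R 0 fun s _ => s :=
  ⟨1, zero_le_one, fun s hs _ _ => by simpa [abs_of_nonneg hs.1] using hs.2⟩

theorem normSq : CoeffBound R 2 fun _ η => ‖η‖ ^ 2 :=
  ⟨1, zero_le_one, fun _ _ η _ => by simp⟩

theorem mul (hw : CoeffBound R p w) (hw' : CoeffBound R p' w') :
    CoeffBound R (p + p') fun s η => w s η * w' s η := by
  obtain ⟨K, hK, h⟩ := hw
  obtain ⟨K', hK', h'⟩ := hw'
  refine ⟨K * K', by positivity, fun s hs η hη => ?_⟩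
  rw [abs_mul]
  calc |w s η| * |w' s η| ≤ (K * ‖η‖ ^ p) * (K' * ‖η‖ ^ p') := by
        gcongr
        exacts [h s hs η hη, h' s hs η hη]
    _ = _ := by ring

theorem mul₀ (hw : CoeffBound R 0 w) (hw' : CoeffBound R p w') :
    CoeffBound R p fun s η => w s η * w' s η := by
  simpa using hw.mul hw'

theorem add (hw : CoeffBound R p w) (hw' : CoeffBound R p w') :
    CoeffBound R p fun s η => w s η + w' s η := by
  obtain ⟨K, hK, h⟩ := hw
  obtain ⟨K', hK', h'⟩ := hw'
  refine ⟨K + K', by positivity, fun s hs η hη => ?_⟩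
  rw [add_mul]
  exact (abs_add_le _ _).trans (add_le_add (h s hs η hη) (h' s hs η hη))

theorem const_mul (hw : CoeffBound R p w) (a : ℝ) : CoeffBound R p fun s η => a * w s η :=
  (const a).mul₀ hw

theorem sub (hw : CoeffBound R p w) (hw' : CoeffBound R p w') :
    CoeffBound R p fun s η => w s η - w' s η := by
  simpa [sub_eq_add_neg] using hw.add (hw'.const_mul (-1))

theorem mono (hw : CoeffBound R p w) (h : p' ≤ p) : CoeffBound R p' w := by
  obtain ⟨K, hK, hw⟩ := hw
  refine ⟨K * |R| ^ (p - p'), by positivity, fun s hs η hη => (hw s hs η hη).trans ?_⟩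
  calc K * ‖η‖ ^ p = K * (‖η‖ ^ (p - p') * ‖η‖ ^ p') := by rw [← pow_add, Nat.sub_add_cancel h]
    _ ≤ K * (|R| ^ (p - p') * ‖η‖ ^ p') := by
      gcongr
      exact hη.trans (le_abs_self R)
    _ = _ := by ring

/-- Boundedness of the derivative `q'(y) = c² - s (ν²/2) y` of the squared frequency. -/
theorem freqSqDeriv (c ν : ℝ) : CoeffBound R 0 fun s η => c ^ 2 - s * (ν ^ 2 / 2) * ‖η‖ ^ 2 :=
  (const (c ^ 2)).sub (((param.mul (const (ν ^ 2 / 2))).mul normSq).mono (Nat.zero_le _))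

end CoeffBound

theorem gaussBound_dampedCos {c ν R : ℝ} (hc : 0 < c) (hν : 0 < ν) (hR : 0 < R) (n : ℕ) {k j p : ℕ}
    (hjk : j ≤ k) (hjp : j ≤ p) {w : ℝ → Plane → ℝ} (hw : CoeffBound R p w) {m : ℝ}
    (hm : (n : ℝ) - (p + j) / 2 ≤ m) :
    GaussBound R m fun s t η => w s η * dampedCos c ν n k s t (‖η‖ ^ 2) := by
  obtain ⟨K, hK, hw⟩ := hw
  refine ((gaussBound_monomial hc hν hR n hjk hjp).mono hm).of_abs_le (K := K)
    fun s hs t ht η hη => ?_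
  have ht0 : 0 ≤ t := by linarith
  rw [dampedCos, abs_mul, mul_assoc (‖η‖ ^ p), abs_mul (‖η‖ ^ p),
    abs_of_nonneg (by positivity : 0 ≤ ‖η‖ ^ p), ← mul_assoc K]
  exact mul_le_mul_of_nonneg_right (hw s hs η hη) (abs_nonneg _)

/-- The coefficient is required to vanish to order `k + 1` at the origin so that every term of
`waveForm_eq` can use the full decay of its `Φ`. -/
theorem gaussBound_waveForm {c ν R : ℝ} (hc : 0 < c) (hν : 0 < ν) (hR : 0 < R) (n : ℕ) {k D : ℕ}
    (hk : 1 ≤ k) (hD : k + 1 ≤ D) {b₀ b₁ b₂ : Plane → ℝ}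
    (h₀ : CoeffBound R D fun _ => b₀) (h₁ : CoeffBound R D fun _ => b₁)
    (h₂ : CoeffBound R (D - 2) fun _ => b₂) :
    GaussBound R (n - (D + k) / 2 + 3 / 2) fun s t η =>
      waveForm c ν n k s t (‖η‖ ^ 2) (b₀ η) (b₁ η) (b₂ η) := by
  have hq := CoeffBound.freqSqDeriv (R := R) c ν
  have hy := CoeffBound.normSq (R := R)
  have hs := CoeffBound.param (R := R)
  have cst := CoeffBound.const (R := R)
  simp only [waveForm_eq]
  refine ((((GaussBound.add ?_ ?_).add ?_).add ?_).add ?_).add ?_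
  · refine gaussBound_dampedCos hc hν hR n (j := k - 1) (by omega) (by omega) h₂ ?_
    have e1 : ((D - 2 : ℕ) : ℝ) = D - 2 := by rw [Nat.cast_sub (by omega)]; norm_num
    have e2 : ((k - 1 : ℕ) : ℝ) = k - 1 := by rw [Nat.cast_sub hk]; norm_num
    rw [e1, e2]
    linarith
  · refine gaussBound_dampedCos hc hν hR (n + 1) (j := k) le_rfl (by omega)
      ((h₁.const_mul _).add (h₀.const_mul _)) ?_
    push_cast
    linarith
  · refine gaussBound_dampedCos hc hν hR (n + 2) (j := k + 1) le_rfl (by omega)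
      (((hq.const_mul 4).mul₀ h₁).add (CoeffBound.mul₀ ((CoeffBound.sub (hq.const_mul 4)
        (((hs.const_mul (2 * ν ^ 2)).mul hy).mono (Nat.zero_le _))).sub
        (cst ((4 * k + 2) * c ^ 2))) h₀)) ?_
    push_cast
    linarith
  · refine gaussBound_dampedCos hc hν hR (n + 2) (j := k) le_rfl (p := 2 + D) (by omega)
      ((hy.const_mul (ν ^ 2)).mul h₀) ?_
    push_cast
    linarith
  · refine gaussBound_dampedCos hc hν hR (n + 3) (j := k + 1) le_rfl (p := 2 + 0 + D) (by omega)
      (((hy.const_mul (-(4 * ν))).mul hq).mul h₀) ?_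
    push_cast
    linarith
  · refine gaussBound_dampedCos hc hν hR (n + 4) (j := k + 2) le_rfl (p := 4 + D) (by omega)
      (w := fun s η => s * ν ^ 2 * (s * ν ^ 2 * ‖η‖ ^ 2 - 3 * c ^ 2) * (‖η‖ ^ 2) ^ 2 * b₀ η) ?_ ?_
    · have hsν := hs.mul (cst (ν ^ 2))
      have h := ((hsν.mul (((hsν.mul hy).mono (Nat.zero_le _)).sub (cst (3 * c ^ 2)))).mul₀
        (hy.mul hy)).mul h₀
      simpa only [← sq] using h
    · push_cast
      linarith

/-- Mean value inequality in the parameter `s`. -/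
theorem GaussBound.image_sub {R m : ℝ} {G G' : ℝ → ℝ → Plane → ℝ} (hG' : GaussBound R m G')
    (h : ∀ s t η, HasDerivAt (fun s => G s t η) (G' s t η) s) :
    GaussBound R m fun _ t η => G 1 t η - G 0 t η := by
  obtain ⟨C, b, hC, hb, hB⟩ := hG'
  refine ⟨C, b, hC, hb, fun _ _ t ht η hη => ?_⟩
  exact norm_image_sub_le_of_norm_deriv_le_segment_01' (f := fun s => G s t η)
    (fun s _ => (h s t η).hasDerivWithinAt)
    (fun s hs => hB s (Set.Ico_subset_Icc_self hs) t ht η hη)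

/-- The difference between the viscous and the wave multiplier is the integral over `s ∈ [0, 1]` of
multipliers with two more powers of `t` and four more powers of `|η|`, a gain of `t^(-1/2)`. -/
theorem gaussBound_dampedCos_sub {c ν R : ℝ} (hc : 0 < c) (hν : 0 < ν) (hR : 0 < R) (n : ℕ)
    {k D : ℕ} (hD : k ≤ D + 2) {b₀ : Plane → ℝ} (h₀ : CoeffBound R D fun _ => b₀) :
    GaussBound R (n - (D + k + 1) / 2) fun _ t η =>
      b₀ η * dampedCos c ν n k 1 t (‖η‖ ^ 2) - b₀ η * dampedCos c ν n k 0 t (‖η‖ ^ 2) := by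
  have hy := CoeffBound.normSq (R := R)
  refine GaussBound.image_sub (G := fun s t η => b₀ η * dampedCos c ν n k s t (‖η‖ ^ 2))
    (gaussBound_dampedCos hc hν hR (n + 2) (k := k + 1) (j := k + 1) le_rfl (p := D + 4) (by omega)
      ((h₀.mul (hy.mul hy)).const_mul (-(ν ^ 2 / 4))) (by push_cast; linarith))
    fun s t η => ?_
  refine HasDerivAt.congr_deriv ((hasDerivAt_dampedCos_param c ν n k s t (‖η‖ ^ 2)).const_mul
    (b₀ η)) ?_
  ring

theorem gaussBound_waveForm_sub {c ν R : ℝ} (hc : 0 < c) (hν : 0 < ν) (hR : 0 < R) (n : ℕ)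
    {k D : ℕ} (hD : k ≤ D + 2) {b₀ b₁ b₂ : Plane → ℝ}
    (h₀ : CoeffBound R D fun _ => b₀) (h₁ : CoeffBound R D fun _ => b₁)
    (h₂ : CoeffBound R (D - 2) fun _ => b₂) :
    GaussBound R (n - (D + k + 1) / 2 + 3 / 2) fun _ t η =>
      waveForm c ν n k 1 t (‖η‖ ^ 2) (b₀ η) (b₁ η) (b₂ η)
        - waveForm c ν n k 0 t (‖η‖ ^ 2) (b₀ η) (b₁ η) (b₂ η) := by
  have hy := CoeffBound.normSq (R := R)
  have hyy : CoeffBound R 4 fun _ η => (‖η‖ ^ 2) ^ 2 := by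
    simpa only [← sq] using hy.mul hy
  have h₀' : CoeffBound R (4 + D) fun _ η => -(ν ^ 2 / 4) * ((‖η‖ ^ 2) ^ 2 * b₀ η) :=
    (hyy.mul h₀).const_mul _
  have h₁' : CoeffBound R (4 + D) fun _ η =>
      -(ν ^ 2 / 4) * (4 * (‖η‖ ^ 2) ^ 2 * b₀ η + (‖η‖ ^ 2) ^ 2 * b₁ η) :=
    (((hyy.const_mul 4).mul h₀).add (hyy.mul h₁)).const_mul _
  have h₂' : CoeffBound R (4 + D - 2) fun _ η =>
      -(ν ^ 2 / 4) * ((‖η‖ ^ 2) ^ 2 * b₂ η + 8 * ‖η‖ ^ 2 * b₁ η + 16 * ‖η‖ ^ 2 * b₀ η) :=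
    CoeffBound.const_mul ((((hyy.mul h₂).mono (by omega)).add
      (((hy.const_mul 8).mul h₁).mono (by omega))).add
      (((hy.const_mul 16).mul h₀).mono (by omega))) _
  refine GaussBound.image_sub
    (G := fun s t η => waveForm c ν n k s t (‖η‖ ^ 2) (b₀ η) (b₁ η) (b₂ η))
    ((gaussBound_waveForm hc hν hR (n + 2) (k := k + 1) (by omega) (by omega) h₀' h₁' h₂').mono
      (by push_cast; linarith))
    fun s t η => hasDerivAt_waveForm_param c ν n k s t (‖η‖ ^ 2) (b₀ η) (b₁ η) (b₂ η)

/-! ### Cut-off monomials and the Laplacian of their products with radial functions -/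

/-- The partial derivative `∂ⱼ` of a real-valued function on the plane. -/
noncomputable def realPartial (j : Fin 2) (f : Plane → ℝ) (η : Plane) : ℝ :=
  fderiv ℝ f η (EuclideanSpace.single j 1)

/-- The Laplacian of a real-valued function on the plane. -/
noncomputable def planeLaplacian (f : Plane → ℝ) (η : Plane) : ℝ :=
  ∑ j, realPartial j (realPartial j f) η

theorem contDiff_realPartial {f : Plane → ℝ} (hf : ContDiff ℝ ∞ f) (j : Fin 2) :
    ContDiff ℝ ∞ (realPartial j f) :=
  (hf.fderiv_right (m := ∞) (by simp)).clm_apply contDiff_const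

theorem realPartial_add {f g : Plane → ℝ} (hf : ContDiff ℝ ∞ f) (hg : ContDiff ℝ ∞ g) (j : Fin 2) :
    realPartial j (fun η => f η + g η) = fun η => realPartial j f η + realPartial j g η := by
  funext η
  simp only [realPartial]
  rw [fderiv_fun_add (hf.differentiable (by simp) η) (hg.differentiable (by simp) η)]
  rfl

theorem realPartial_mul {f g : Plane → ℝ} (hf : ContDiff ℝ ∞ f) (hg : ContDiff ℝ ∞ g) (j : Fin 2) :
    realPartial j (fun η => f η * g η) =
      fun η => realPartial j f η * g η + f η * realPartial j g η := by
  funext η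
  simp only [realPartial]
  rw [fderiv_fun_mul (hf.differentiable (by simp) η) (hg.differentiable (by simp) η)]
  simp only [add_apply, smul_apply, smul_eq_mul]
  ring

theorem realPartial_const_mul {f : Plane → ℝ} (hf : ContDiff ℝ ∞ f) (a : ℝ) (j : Fin 2) :
    realPartial j (fun η => a * f η) = fun η => a * realPartial j f η := by
  funext η
  simp only [realPartial]
  rw [fderiv_const_mul (hf.differentiable (by simp) η)]
  rfl

theorem contDiff_coord (i : Fin 2) : ContDiff ℝ ∞ fun η : Plane => η i :=
  (EuclideanSpace.proj i : Plane →L[ℝ] ℝ).contDiff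

theorem realPartial_coord (i j : Fin 2) :
    realPartial j (fun η : Plane => η i) = fun _ => if i = j then 1 else 0 := by
  funext η
  have h : HasFDerivAt (fun η : Plane => η i)
      (EuclideanSpace.proj i : Plane →L[ℝ] ℝ) η :=
    (EuclideanSpace.proj i : Plane →L[ℝ] ℝ).hasFDerivAt
  rw [realPartial, h.fderiv]
  simp

theorem realPartial_radial {F F' : ℝ → ℝ} (hF : ∀ y, HasDerivAt F (F' y) y) (j : Fin 2) :
    realPartial j (fun η => F (‖η‖ ^ 2)) = fun η => 2 * η j * F' (‖η‖ ^ 2) := by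
  funext η
  have h := (hF (‖η‖ ^ 2)).comp_hasFDerivAt η (hasStrictFDerivAt_norm_sq η).hasFDerivAt
  have h' : HasFDerivAt (fun η : Plane => F (‖η‖ ^ 2)) _ η := h
  rw [realPartial, h'.fderiv]
  simp [EuclideanSpace.inner_single_right]
  ring

theorem planeLaplacian_add {f g : Plane → ℝ} (hf : ContDiff ℝ ∞ f) (hg : ContDiff ℝ ∞ g)
    (η : Plane) :
    planeLaplacian (fun η => f η + g η) η = planeLaplacian f η + planeLaplacian g η := by
  simp only [planeLaplacian, realPartial_add hf hg, ← Finset.sum_add_distrib]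
  refine Finset.sum_congr rfl fun j _ => ?_
  rw [realPartial_add (contDiff_realPartial hf j) (contDiff_realPartial hg j)]

theorem planeLaplacian_const_mul {f : Plane → ℝ} (hf : ContDiff ℝ ∞ f) (a : ℝ) (η : Plane) :
    planeLaplacian (fun η => a * f η) η = a * planeLaplacian f η := by
  simp only [planeLaplacian, realPartial_const_mul hf, Finset.mul_sum]
  refine Finset.sum_congr rfl fun j _ => ?_
  rw [realPartial_const_mul (contDiff_realPartial hf j)]

theorem contDiff_radial {F : ℝ → ℝ} (hF : ContDiff ℝ ∞ F) :
    ContDiff ℝ ∞ fun η : Plane => F (‖η‖ ^ 2) :=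
  hF.comp (contDiff_norm_sq ℝ)

theorem planeLaplacian_mul_radial {B : Plane → ℝ} (hB : ContDiff ℝ ∞ B) {F F' F'' : ℝ → ℝ}
    (hFs : ContDiff ℝ ∞ F) (hF : ∀ y, HasDerivAt F (F' y) y) (hF' : ∀ y, HasDerivAt F' (F'' y) y)
    (η : Plane) :
    planeLaplacian (fun η => B η * F (‖η‖ ^ 2)) η =
      planeLaplacian B η * F (‖η‖ ^ 2) + 4 * (∑ j, η j * realPartial j B η) * F' (‖η‖ ^ 2)
        + B η * (4 * F' (‖η‖ ^ 2) + 4 * ‖η‖ ^ 2 * F'' (‖η‖ ^ 2)) := by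
  have hFs' : ContDiff ℝ ∞ F' := by
    have : deriv F = F' := funext fun y => (hF y).deriv
    rw [← this]
    exact (contDiff_infty_iff_deriv.1 hFs).2
  have hr := contDiff_radial hFs
  have hr' := contDiff_radial hFs'
  have key : ∀ j : Fin 2, realPartial j (realPartial j fun η => B η * F (‖η‖ ^ 2)) η =
      realPartial j (realPartial j B) η * F (‖η‖ ^ 2)
        + 4 * (η j * realPartial j B η) * F' (‖η‖ ^ 2)
        + B η * (2 * F' (‖η‖ ^ 2) + 4 * (η j) ^ 2 * F'' (‖η‖ ^ 2)) := by
    intro j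
    have hBj := contDiff_realPartial hB j
    have hc : ContDiff ℝ ∞ fun η : Plane => 2 * η j := contDiff_const.mul (contDiff_coord j)
    rw [realPartial_mul hB hr, realPartial_radial hF,
      realPartial_add (hBj.mul hr) (hB.mul (hc.mul hr')), realPartial_mul hBj hr,
      realPartial_mul hB (hc.mul hr'), realPartial_mul hc hr', realPartial_radial hF,
      realPartial_radial hF', realPartial_const_mul (contDiff_coord j), realPartial_coord]
    simp only [if_true]
    ring
  have hn : ‖η‖ ^ 2 = η 0 ^ 2 + η 1 ^ 2 := by
    have h := EuclideanSpace.norm_sq_eq η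
    simpa only [Fin.sum_univ_two, Real.norm_eq_abs, sq_abs] using h
  simp only [planeLaplacian, Fin.sum_univ_two, key]
  rw [hn]
  ring

/-- A smooth amplitude vanishing for `|η| ≥ R` and, with its pure derivatives of order at most two,
vanishing at the origin like a homogeneous polynomial of degree `D` (like a bounded function for the
derivatives of order larger than `D`). -/
structure VanishesToOrder (R : ℝ) (D : ℕ) (B : Plane → ℝ) : Prop where
  smooth : ContDiff ℝ ∞ B
  eq_zero : ∀ η, R ≤ ‖η‖ → B η = 0
  bound : CoeffBound R D fun _ => B
  bound_partial : ∀ j, CoeffBound R (D - 1) fun _ => realPartial j B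
  bound_partial₂ : ∀ j, CoeffBound R (D - 2) fun _ => realPartial j (realPartial j B)

theorem coeffBound_zero_of_continuous (R : ℝ) {f : Plane → ℝ} (hf : Continuous f) :
    CoeffBound R 0 fun _ => f := by
  obtain ⟨K, hK⟩ := (isCompact_closedBall (0 : Plane) R).exists_bound_of_continuousOn
    hf.continuousOn
  refine ⟨max K 0, le_max_right _ _, fun _ _ η hη => ?_⟩
  rw [pow_zero, mul_one]
  exact (hK η (by simpa using hη)).trans (le_max_left _ _)

theorem coeffBound_coord (R : ℝ) (i : Fin 2) : CoeffBound R 1 fun _ (η : Plane) => η i :=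
  ⟨1, zero_le_one, fun _ _ η _ => by simpa using PiLp.norm_apply_le η i⟩

namespace VanishesToOrder

variable {R : ℝ} {D : ℕ} {B B' : Plane → ℝ}

theorem of_smooth (hB : ContDiff ℝ ∞ B) (h : ∀ η, R ≤ ‖η‖ → B η = 0) : VanishesToOrder R 0 B where
  smooth := hB
  eq_zero := h
  bound := coeffBound_zero_of_continuous R hB.continuous
  bound_partial j := coeffBound_zero_of_continuous R (contDiff_realPartial hB j).continuous
  bound_partial₂ j := coeffBound_zero_of_continuous R
    (contDiff_realPartial (contDiff_realPartial hB j) j).continuous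

theorem add (hB : VanishesToOrder R D B) (hB' : VanishesToOrder R D B') :
    VanishesToOrder R D fun η => B η + B' η where
  smooth := hB.smooth.add hB'.smooth
  eq_zero η hη := by rw [hB.eq_zero η hη, hB'.eq_zero η hη, add_zero]
  bound := hB.bound.add hB'.bound
  bound_partial j := by
    rw [realPartial_add hB.smooth hB'.smooth]
    exact (hB.bound_partial j).add (hB'.bound_partial j)
  bound_partial₂ j := by
    rw [realPartial_add hB.smooth hB'.smooth,
      realPartial_add (contDiff_realPartial hB.smooth j) (contDiff_realPartial hB'.smooth j)]
    exact (hB.bound_partial₂ j).add (hB'.bound_partial₂ j)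

theorem coord_mul (hB : VanishesToOrder R D B) (i : Fin 2) :
    VanishesToOrder R (D + 1) fun η => η i * B η where
  smooth := (contDiff_coord i).mul hB.smooth
  eq_zero η hη := by rw [hB.eq_zero η hη, mul_zero]
  bound := ((coeffBound_coord R i).mul hB.bound).mono (by omega)
  bound_partial j := by
    rw [realPartial_mul (contDiff_coord i) hB.smooth, realPartial_coord]
    exact ((CoeffBound.const _).mul₀ hB.bound).add
      (((coeffBound_coord R i).mul (hB.bound_partial j)).mono (by omega))
  bound_partial₂ j := by
    have hs := contDiff_realPartial hB.smooth j
    rw [realPartial_mul (contDiff_coord i) hB.smooth, realPartial_coord,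
      realPartial_add (contDiff_const.mul hB.smooth) ((contDiff_coord i).mul hs),
      realPartial_const_mul hB.smooth, realPartial_mul (contDiff_coord i) hs, realPartial_coord]
    exact (((hB.bound_partial j).mono (by omega)).const_mul _).add
      ((((hB.bound_partial j).mono (by omega)).const_mul _).add
        (((coeffBound_coord R i).mul (hB.bound_partial₂ j)).mono (by omega)))

theorem normSq_mul (hB : VanishesToOrder R D B) :
    VanishesToOrder R (D + 2) fun η => ‖η‖ ^ 2 * B η := by
  have h := ((hB.coord_mul 0).coord_mul 0).add ((hB.coord_mul 1).coord_mul 1)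
  have e : (fun η : Plane => ‖η‖ ^ 2 * B η) = fun η => η 0 * (η 0 * B η) + η 1 * (η 1 * B η) := by
    funext η
    have hn := EuclideanSpace.norm_sq_eq η
    simp only [Fin.sum_univ_two, Real.norm_eq_abs, sq_abs] at hn
    rw [hn]
    ring
  rw [e]
  exact h

theorem bound_euler (hB : VanishesToOrder R D B) :
    CoeffBound R D fun _ η => ∑ j, η j * realPartial j B η := by
  simp only [Fin.sum_univ_two]
  exact (((coeffBound_coord R 0).mul (hB.bound_partial 0)).mono (by omega)).add
    (((coeffBound_coord R 1).mul (hB.bound_partial 1)).mono (by omega))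

theorem bound_laplacian (hB : VanishesToOrder R D B) :
    CoeffBound R (D - 2) fun _ => planeLaplacian B := by
  have e : planeLaplacian B = fun η =>
      realPartial 0 (realPartial 0 B) η + realPartial 1 (realPartial 1 B) η :=
    funext fun η => Fin.sum_univ_two _
  rw [e]
  exact (hB.bound_partial₂ 0).add (hB.bound_partial₂ 1)

end VanishesToOrder

theorem contDiff_mul_dampedCos {B : Plane → ℝ} (hB : ContDiff ℝ ∞ B)
    (c ν : ℝ) (n k : ℕ) (s t : ℝ) :
    ContDiff ℝ ∞ fun η => B η * dampedCos c ν n k s t (‖η‖ ^ 2) :=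
  hB.mul (contDiff_radial (contDiff_dampedCos c ν n k s t))

theorem wave_mul_dampedCos {B : Plane → ℝ} (hB : ContDiff ℝ ∞ B)
    (c ν : ℝ) (n k : ℕ) (s t : ℝ) (η : Plane) :
    planeLaplacian (fun η => B η * dampedCos c ν n k s t (‖η‖ ^ 2)) η
        + c ^ 2 * t ^ 2 * (B η * dampedCos c ν n k s t (‖η‖ ^ 2)) =
      waveForm c ν n k s t (‖η‖ ^ 2) (B η) (∑ j, η j * realPartial j B η)
        (planeLaplacian B η) := by
  rw [planeLaplacian_mul_radial hB (contDiff_dampedCos c ν n k s t)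
    (hasDerivAt_dampedCos c ν n k s t) (hasDerivAt_dampedCosDeriv c ν n k s t), waveForm]
  ring

/-- A family of smooth multipliers supported in `|η| ≤ R`, of size `tᵐ` on Gaussian scales, on which
`Δ + c²t²` costs a factor `t^(3/2)` only: a localisation, up to distance `√t`, of the kernel near the
light cone `|x| = c t`. -/
structure ConeLocalized (c R m : ℝ) (G : ℝ → Plane → ℝ) : Prop where
  smooth : ∀ t, ContDiff ℝ ∞ (G t)
  eq_zero : ∀ t η, R ≤ ‖η‖ → G t η = 0
  bound : GaussBound R m fun _ => G
  bound_wave : GaussBound R (m + 3 / 2) fun _ t η =>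
    planeLaplacian (G t) η + c ^ 2 * t ^ 2 * G t η

namespace ConeLocalized

variable {c ν R m : ℝ} {G G' : ℝ → Plane → ℝ}

theorem add (hG : ConeLocalized c R m G) (hG' : ConeLocalized c R m G') :
    ConeLocalized c R m fun t η => G t η + G' t η where
  smooth t := (hG.smooth t).add (hG'.smooth t)
  eq_zero t η hη := by rw [hG.eq_zero t η hη, hG'.eq_zero t η hη, add_zero]
  bound := hG.bound.add hG'.bound
  bound_wave := (hG.bound_wave.add hG'.bound_wave).congr fun _ _ t _ η _ => by
    rw [planeLaplacian_add (hG.smooth t) (hG'.smooth t)]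
    ring

theorem const_mul (hG : ConeLocalized c R m G) (a : ℝ) :
    ConeLocalized c R m fun t η => a * G t η where
  smooth t := contDiff_const.mul (hG.smooth t)
  eq_zero t η hη := by rw [hG.eq_zero t η hη, mul_zero]
  bound := hG.bound.const_mul a
  bound_wave := (hG.bound_wave.const_mul a).congr fun _ _ t _ η _ => by
    rw [planeLaplacian_const_mul (hG.smooth t)]
    ring

theorem mul_dampedCos (hc : 0 < c) (hν : 0 < ν) (hR : 0 < R) (n : ℕ) {k D : ℕ}
    (hk : 1 ≤ k) (hD : k + 1 ≤ D) {B : Plane → ℝ} (hB : VanishesToOrder R D B) :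
    ConeLocalized c R (n - (D + k) / 2) fun t η => B η * dampedCos c ν n k 1 t (‖η‖ ^ 2) where
  smooth t := contDiff_mul_dampedCos hB.smooth c ν n k 1 t
  eq_zero t η hη := by rw [hB.eq_zero η hη, zero_mul]
  bound := by
    obtain ⟨C, b, hC, hb, h⟩ := gaussBound_dampedCos hc hν hR n (j := k) le_rfl (by omega)
      hB.bound le_rfl
    exact ⟨C, b, hC, hb, fun _ _ => h 1 (by simp)⟩
  bound_wave := by
    obtain ⟨C, b, hC, hb, h⟩ := gaussBound_waveForm hc hν hR n hk hD hB.bound hB.bound_euler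
      hB.bound_laplacian
    refine ⟨C, b, hC, hb, fun _ _ t ht η hη => ?_⟩
    have e := wave_mul_dampedCos hB.smooth c ν n k 1 t η
    exact (congrArg abs e).trans_le (h 1 (by simp) t ht η hη)

theorem mul_dampedCos_sub (hc : 0 < c) (hν : 0 < ν) (hR : 0 < R) (n : ℕ) {k D : ℕ}
    (hD : k ≤ D + 2) {B : Plane → ℝ} (hB : VanishesToOrder R D B) :
    ConeLocalized c R (n - (D + k + 1) / 2) fun t η =>
      B η * dampedCos c ν n k 1 t (‖η‖ ^ 2) - B η * dampedCos c ν n k 0 t (‖η‖ ^ 2) where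
  smooth t := (contDiff_mul_dampedCos hB.smooth c ν n k 1 t).sub
    (contDiff_mul_dampedCos hB.smooth c ν n k 0 t)
  eq_zero t η hη := by rw [hB.eq_zero η hη, zero_mul, zero_mul, sub_zero]
  bound := gaussBound_dampedCos_sub hc hν hR n hD hB.bound
  bound_wave := (gaussBound_waveForm_sub hc hν hR n hD hB.bound hB.bound_euler
      hB.bound_laplacian).congr fun _ _ t _ η _ => by
    have h1 := contDiff_mul_dampedCos hB.smooth c ν n k 1 t
    have h0 := contDiff_mul_dampedCos hB.smooth c ν n k 0 t
    have e := planeLaplacian_add h1 (contDiff_const.mul h0 : ContDiff ℝ ∞ fun η : Plane =>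
      (-1 : ℝ) * (B η * dampedCos c ν n k 0 t (‖η‖ ^ 2))) η
    rw [planeLaplacian_const_mul h0] at e
    simp only [neg_one_mul, ← sub_eq_add_neg] at e
    rw [e, ← wave_mul_dampedCos hB.smooth, ← wave_mul_dampedCos hB.smooth]
    ring

end ConeLocalized

/-! ### Inverse Fourier transforms of compactly supported multipliers -/

/-- The inverse Fourier transform `x ↦ (2π)⁻² ∫ exp (-i η·x) g(η) dη` for the convention
`f̂(η) = ∫ f(x) exp (i η·x) dx`. -/
noncomputable def invFourier (g : Plane → ℂ) (x : Plane) : ℂ :=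
  ((2 * Real.pi : ℝ) : ℂ)⁻¹ ^ 2 *
    ∫ η : Plane, Complex.exp (-(Complex.I * (inner ℝ η x : ℝ))) * g η

open scoped FourierTransform in
theorem invFourier_eq_fourier (g : Plane → ℂ) (x : Plane) :
    invFourier g x = ((2 * Real.pi : ℝ) : ℂ)⁻¹ ^ 2 * 𝓕 g ((2 * Real.pi)⁻¹ • x) := by
  rw [invFourier, Real.fourier_eq']
  congr 1
  refine integral_congr_ae (Eventually.of_forall fun η => ?_)
  simp only [smul_eq_mul]
  congr 2
  rw [inner_smul_right]
  have hpi : (Real.pi : ℂ) ≠ 0 := by exact_mod_cast Real.pi_ne_zero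
  push_cast
  field_simp

theorem invFourier_congr_ae {g h : Plane → ℂ} (e : g =ᵐ[volume] h) : invFourier g = invFourier h := by
  funext x
  rw [invFourier, invFourier]
  congr 1
  refine integral_congr_ae ?_
  filter_upwards [e] with η hη
  rw [hη]

theorem norm_fourierPhase (η x : Plane) :
    ‖Complex.exp (-(Complex.I * (inner ℝ η x : ℝ)))‖ = 1 := by
  rw [Complex.norm_exp]
  simp

theorem integrable_fourierPhase_mul {g : Plane → ℂ} (hg : Integrable g) (x : Plane) :
    Integrable fun η : Plane => Complex.exp (-(Complex.I * (inner ℝ η x : ℝ))) * g η :=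
  hg.bdd_mul (c := 1) (Continuous.aestronglyMeasurable (by fun_prop))
    (Eventually.of_forall fun η => (norm_fourierPhase η x).le)

theorem invFourier_sub {g h : Plane → ℂ} (hg : Integrable g) (hh : Integrable h) (x : Plane) :
    invFourier (fun η => g η - h η) x = invFourier g x - invFourier h x := by
  simp only [invFourier, mul_sub]
  rw [integral_sub (integrable_fourierPhase_mul hg x) (integrable_fourierPhase_mul hh x), mul_sub]

theorem invFourier_add {g h : Plane → ℂ} (hg : Integrable g) (hh : Integrable h) (x : Plane) :
    invFourier (fun η => g η + h η) x = invFourier g x + invFourier h x := by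
  simp only [invFourier, mul_add]
  rw [integral_add (integrable_fourierPhase_mul hg x) (integrable_fourierPhase_mul hh x), mul_add]

theorem invFourier_const_mul (a : ℂ) (g : Plane → ℂ) (x : Plane) :
    invFourier (fun η => a * g η) x = a * invFourier g x := by
  simp only [invFourier, mul_left_comm _ a, integral_const_mul]

theorem norm_invFourier_le (g : Plane → ℂ) (x : Plane) : ‖invFourier g x‖ ≤ ∫ η, ‖g η‖ := by
  have h1 : ‖(((2 * Real.pi : ℝ) : ℂ)⁻¹ ^ 2)‖ ≤ 1 := by
    rw [norm_pow, norm_inv, Complex.norm_real, Real.norm_of_nonneg (by positivity)]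
    exact pow_le_one₀ (by positivity) (inv_le_one_of_one_le₀ (by linarith [Real.pi_gt_three]))
  rw [invFourier, norm_mul]
  calc _ ≤ 1 * ‖∫ η : Plane, Complex.exp (-(Complex.I * (inner ℝ η x : ℝ))) * g η‖ := by gcongr
    _ ≤ 1 * ∫ η : Plane, ‖Complex.exp (-(Complex.I * (inner ℝ η x : ℝ))) * g η‖ := by
      gcongr
      exact norm_integral_le_integral_norm _
    _ = ∫ η, ‖g η‖ := by simp only [norm_mul, norm_fourierPhase, one_mul]

theorem integrable_norm_pow_mul {g : Plane → ℂ} (hg : Continuous g) (hs : HasCompactSupport g)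
    (n : ℕ) : Integrable fun η => ‖η‖ ^ n * ‖g η‖ :=
  ((continuous_norm.pow n).mul hg.norm).integrable_of_hasCompactSupport hs.norm.mul_left

theorem contDiff_invFourier {g : Plane → ℂ} (hg : Continuous g) (hs : HasCompactSupport g) :
    ContDiff ℝ ∞ (invFourier g) := by
  have h := Real.contDiff_fourier (f := g) (N := ⊤) fun n _ => integrable_norm_pow_mul hg hs n
  have e : invFourier g = fun x => ((2 * Real.pi : ℝ) : ℂ)⁻¹ ^ 2 *
      FourierTransform.fourier g ((2 * Real.pi)⁻¹ • x) := funext (invFourier_eq_fourier g)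
  rw [e]
  exact contDiff_const.mul (h.comp (contDiff_const_smul _))

theorem partialDeriv_invFourier {g : Plane → ℂ} (hg : Continuous g) (hs : HasCompactSupport g)
    (j : Fin 2) :
    partialDeriv j (invFourier g) = invFourier fun η => -Complex.I * ((η j : ℂ) * g η) := by
  have hi : Integrable g := hg.integrable_of_hasCompactSupport hs
  have hvi : Integrable fun η => ‖η‖ * ‖g η‖ := by simpa using integrable_norm_pow_mul hg hs 1
  funext x
  have h := Real.hasFDerivAt_fourier hi hvi ((2 * Real.pi)⁻¹ • x)
  have hdil : HasFDerivAt (fun x : Plane => (2 * Real.pi)⁻¹ • x)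
      ((2 * Real.pi)⁻¹ • ContinuousLinearMap.id ℝ Plane) x :=
    ((2 * Real.pi)⁻¹ • ContinuousLinearMap.id ℝ Plane).hasFDerivAt
  have h2 := (h.comp x hdil).const_mul (((2 * Real.pi : ℝ) : ℂ)⁻¹ ^ 2)
  have h3 := h2.congr_of_eventuallyEq (f₁ := invFourier g)
    (Eventually.of_forall (invFourier_eq_fourier g))
  have hint : Integrable (VectorFourier.fourierSMulRight (innerSL ℝ) g) := by
    refine (hvi.const_mul (2 * Real.pi * ‖innerSL ℝ (E := Plane)‖)).mono'
      (hg.aestronglyMeasurable.fourierSMulRight) (Eventually.of_forall fun η => ?_)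
    refine (VectorFourier.norm_fourierSMulRight_le (innerSL ℝ) g η).trans_eq ?_
    ring
  rw [partialDeriv, h3.fderiv, invFourier_eq_fourier]
  simp only [ContinuousLinearMap.comp_apply, smul_apply, ContinuousLinearMap.id_apply]
  rw [smul_eq_mul]
  congr 1
  rw [map_smul, Real.fourier_eq, Real.fourier_eq,
    ContinuousLinearMap.integral_apply ((Real.fourierIntegral_convergent_iff _).2 hint),
    ← integral_smul]
  refine integral_congr_ae (Eventually.of_forall fun η => ?_)
  simp only [Circle.smul_def, smul_apply, VectorFourier.fourierSMulRight_apply,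
    innerSL_apply_apply ℝ, EuclideanSpace.inner_single_right, Complex.real_smul, smul_eq_mul]
  have hpi : (Real.pi : ℂ) ≠ 0 := by exact_mod_cast Real.pi_ne_zero
  simp
  field_simp

/-- The monomial `η₁^σ₁ η₂^σ₂`. -/
def monomial (σ : Fin 2 → ℕ) (η : Plane) : ℝ := η 0 ^ σ 0 * η 1 ^ σ 1

theorem iterate_partialDeriv_invFourier {g : Plane → ℂ} (hg : Continuous g)
    (hs : HasCompactSupport g) (j : Fin 2) (n : ℕ) :
    (partialDeriv j)^[n] (invFourier g) =
      invFourier fun η => (-Complex.I) ^ n * (((η j ^ n : ℝ) : ℂ) * g η) := by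
  induction n with
  | zero => simp
  | succ n ih =>
    have hc : Continuous fun η : Plane => (-Complex.I) ^ n * (((η j ^ n : ℝ) : ℂ) * g η) := by
      have := (contDiff_coord j).continuous
      fun_prop
    rw [Function.iterate_succ_apply', ih, partialDeriv_invFourier hc (hs.mul_left.mul_left)]
    congr 1
    funext η
    push_cast
    ring

theorem multiDeriv_invFourier {g : Plane → ℂ} (hg : Continuous g) (hs : HasCompactSupport g)
    (σ : Fin 2 → ℕ) :
    multiDeriv σ (invFourier g) =
      invFourier fun η => (-Complex.I) ^ multiLength σ * ((monomial σ η : ℂ) * g η) := by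
  have hc : Continuous fun η : Plane =>
      (-Complex.I) ^ σ 1 * (((η 1 ^ σ 1 : ℝ) : ℂ) * g η) := by
    have := (contDiff_coord 1).continuous
    fun_prop
  rw [multiDeriv, iterate_partialDeriv_invFourier hg hs,
    iterate_partialDeriv_invFourier hc (hs.mul_left.mul_left)]
  congr 1
  funext η
  simp only [multiLength, Fin.sum_univ_two, monomial, pow_add]
  push_cast
  ring

section RealMultiplier

variable {G : Plane → ℝ}

theorem contDiff_ofReal_comp (hG : ContDiff ℝ ∞ G) : ContDiff ℝ ∞ fun η => (G η : ℂ) :=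
  Complex.ofRealCLM.contDiff.comp hG

theorem hasCompactSupport_ofReal_comp (hs : HasCompactSupport G) :
    HasCompactSupport fun η => (G η : ℂ) :=
  hs.comp_left (g := fun r : ℝ => (r : ℂ)) Complex.ofReal_zero

theorem hasCompactSupport_realPartial (hs : HasCompactSupport G) (j : Fin 2) :
    HasCompactSupport (realPartial j G) :=
  hs.fderiv_apply (𝕜 := ℝ) _

theorem exists_schwartz_invFourier (hG : ContDiff ℝ ∞ G) (hs : HasCompactSupport G) :
    ∃ φ : SchwartzMap Plane ℂ, (∀ x, invFourier (fun η => (G η : ℂ)) x =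
        ((2 * Real.pi : ℝ) : ℂ)⁻¹ ^ 2 * φ ((2 * Real.pi)⁻¹ • x)) ∧
      ∫ x, ‖φ x‖ ^ 2 = ∫ η, G η ^ 2 := by
  refine ⟨FourierTransform.fourier ((hasCompactSupport_ofReal_comp hs).toSchwartzMap
    (contDiff_ofReal_comp hG)), fun x => ?_, ?_⟩
  · rw [invFourier_eq_fourier]
    rfl
  · rw [SchwartzMap.integral_norm_sq_fourier]
    simp

theorem integrable_invFourier (hG : ContDiff ℝ ∞ G) (hs : HasCompactSupport G) :
    Integrable (invFourier fun η => (G η : ℂ)) := by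
  obtain ⟨φ, h, -⟩ := exists_schwartz_invFourier hG hs
  rw [funext h]
  exact (φ.integrable.comp_smul (by positivity)).const_mul _

theorem integrable_norm_sq_invFourier (hG : ContDiff ℝ ∞ G) (hs : HasCompactSupport G) :
    Integrable fun x => ‖invFourier (fun η => (G η : ℂ)) x‖ ^ 2 := by
  obtain ⟨φ, h, -⟩ := exists_schwartz_invFourier hG hs
  have h2 : Integrable fun x => ‖φ x‖ ^ 2 := by
    have := (φ.memLp 2 (volume : Measure Plane)).integrable_norm_pow (by norm_num)
    simpa using this
  simp only [h, norm_mul, mul_pow]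
  exact (h2.comp_smul (R := (2 * Real.pi)⁻¹) (by positivity)).const_mul _

/-- Plancherel's identity, with the constant `(2π)⁻² ≤ 1` dropped. -/
theorem integral_norm_sq_invFourier_le (hG : ContDiff ℝ ∞ G) (hs : HasCompactSupport G) :
    ∫ x, ‖invFourier (fun η => (G η : ℂ)) x‖ ^ 2 ≤ ∫ η, G η ^ 2 := by
  obtain ⟨φ, h, hφ⟩ := exists_schwartz_invFourier hG hs
  have e := Measure.integral_comp_smul volume (fun x => ‖φ x‖ ^ 2) (2 * Real.pi)⁻¹
  simp only [h, norm_mul, mul_pow]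
  rw [integral_const_mul, e, hφ, finrank_euclideanSpace_fin, smul_eq_mul, ← mul_assoc]
  have hnn : 0 ≤ ∫ η, G η ^ 2 := integral_nonneg fun η => sq_nonneg _
  refine mul_le_of_le_one_left hnn ?_
  rw [norm_pow, norm_inv, Complex.norm_real, Real.norm_of_nonneg (by positivity),
    abs_of_nonneg (by positivity)]
  have hpi : 1 ≤ 2 * Real.pi := by linarith [Real.pi_gt_three]
  field_simp
  nlinarith

theorem invFourier_realPartial (hG : ContDiff ℝ ∞ G) (hs : HasCompactSupport G) (j : Fin 2)
    (x : Plane) : invFourier (fun η => (realPartial j G η : ℂ)) x =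
      Complex.I * (x j * invFourier (fun η => (G η : ℂ)) x) := by
  set g := (hasCompactSupport_ofReal_comp hs).toSchwartzMap (contDiff_ofReal_comp hG) with hg
  have e : (fun η => (realPartial j G η : ℂ)) =
      LineDeriv.lineDerivOp (EuclideanSpace.single j (1 : ℝ)) g := by
    funext η
    rw [SchwartzMap.lineDerivOp_apply_eq_fderiv]
    have h := (Complex.ofRealCLM.hasFDerivAt (x := G η)).comp η
      ((hG.differentiable (by simp) η).hasFDerivAt)
    have h' : HasFDerivAt (g : Plane → ℂ) _ η := h
    rw [h'.fderiv]
    simp [realPartial]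
  have e2 := congrFun (congrArg (fun f : SchwartzMap Plane ℂ => (f : Plane → ℂ))
    (SchwartzMap.fourier_lineDerivOp_eq g (EuclideanSpace.single j (1 : ℝ)))) ((2 * Real.pi)⁻¹ • x)
  have ht : (inner ℝ · (EuclideanSpace.single j (1 : ℝ)) : Plane → ℝ).HasTemperateGrowth := by
    fun_prop
  rw [invFourier_eq_fourier, invFourier_eq_fourier, e]
  rw [smul_apply, SchwartzMap.smulLeftCLM_apply_apply ht, SchwartzMap.fourier_coe,
    SchwartzMap.fourier_coe] at e2
  rw [e2]
  have hpi : (Real.pi : ℂ) ≠ 0 := by exact_mod_cast Real.pi_ne_zero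
  have e3 : (g : Plane → ℂ) = fun η => (G η : ℂ) := rfl
  rw [e3]
  simp [inner_smul_left, EuclideanSpace.inner_single_right]
  field_simp

/-- Under the Fourier transform, `Δ + L` becomes multiplication by `L - |x|²`. -/
theorem invFourier_laplacian_add (hG : ContDiff ℝ ∞ G) (hs : HasCompactSupport G) (L : ℝ)
    (x : Plane) : invFourier (fun η => ((planeLaplacian G η + L * G η : ℝ) : ℂ)) x =
      ((L - ‖x‖ ^ 2 : ℝ) : ℂ) * invFourier (fun η => (G η : ℂ)) x := by
  have hint : ∀ {H : Plane → ℝ}, ContDiff ℝ ∞ H → HasCompactSupport H →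
      Integrable fun η => (H η : ℂ) := fun hH hsH =>
    (contDiff_ofReal_comp hH).continuous.integrable_of_hasCompactSupport
      (hasCompactSupport_ofReal_comp hsH)
  have h2 : ∀ j, ContDiff ℝ ∞ (realPartial j (realPartial j G)) := fun j =>
    contDiff_realPartial (contDiff_realPartial hG j) j
  have s2 : ∀ j, HasCompactSupport (realPartial j (realPartial j G)) := fun j =>
    hasCompactSupport_realPartial (hasCompactSupport_realPartial hs j) j
  have key : ∀ j, invFourier (fun η => (realPartial j (realPartial j G) η : ℂ)) x =
      -(x j : ℂ) ^ 2 * invFourier (fun η => (G η : ℂ)) x := by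
    intro j
    rw [invFourier_realPartial (contDiff_realPartial hG j) (hasCompactSupport_realPartial hs j),
      invFourier_realPartial hG hs]
    linear_combination (x j : ℂ) ^ 2 * invFourier (fun η => (G η : ℂ)) x * Complex.I_sq
  have hn : ‖x‖ ^ 2 = x 0 ^ 2 + x 1 ^ 2 := by
    have h := EuclideanSpace.norm_sq_eq x
    simpa only [Fin.sum_univ_two, Real.norm_eq_abs, sq_abs] using h
  have a₁ := invFourier_add (hint (h2 0) (s2 0)) (hint (h2 1) (s2 1)) x
  have a₂ := invFourier_add (g := fun η => (realPartial 0 (realPartial 0 G) η : ℂ)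
      + (realPartial 1 (realPartial 1 G) η : ℂ)) (h := fun η => (L : ℂ) * (G η : ℂ))
    ((hint (h2 0) (s2 0)).add (hint (h2 1) (s2 1))) ((hint hG hs).const_mul _) x
  simp only [planeLaplacian, Fin.sum_univ_two, Complex.ofReal_add, Complex.ofReal_mul]
  rw [a₂, a₁, invFourier_const_mul, key, key, hn]
  push_cast
  ring

end RealMultiplier

/-! ### Weighted estimates and interpolation -/

theorem integrable_gaussian {a : ℝ} (ha : 0 < a) :
    Integrable (fun η : Plane => Real.exp (-(a * ‖η‖ ^ 2))) := by
  have h := GaussianFourier.integrable_cexp_neg_mul_sq_norm_add (V := Plane) (b := (a : ℂ))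
    (by simpa using ha) 0 0
  refine h.norm.congr (Eventually.of_forall fun η => ?_)
  simp only [Complex.norm_exp]
  congr 1
  simp [← Complex.ofReal_pow, ← Complex.ofReal_mul]

theorem integral_gaussian_plane {a : ℝ} (ha : 0 < a) :
    ∫ η : Plane, Real.exp (-(a * ‖η‖ ^ 2)) = Real.pi / a := by
  have h := GaussianFourier.integral_rexp_neg_mul_sq_norm (V := Plane) ha
  rw [finrank_euclideanSpace_fin] at h
  simpa using h

theorem GaussBound.exists_integral_le {R m : ℝ} {G : ℝ → Plane → ℝ}
    (hG : GaussBound R m fun _ => G) (h0 : ∀ t η, R < ‖η‖ → G t η = 0) :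
    ∃ K : ℝ, 0 < K ∧ ∀ t : ℝ, 1 ≤ t →
      ∫ η, |G t η| ≤ K * t ^ (m - 1) ∧ ∫ η, G t η ^ 2 ≤ K * t ^ (2 * m - 1) := by
  obtain ⟨C, b, hC, hb, hB⟩ := hG
  refine ⟨C * (Real.pi / b) + C ^ 2 * (Real.pi / b), by positivity, fun t ht => ?_⟩
  have ht0 : 0 < t := by linarith
  have hbt : 0 < b * t := by positivity
  have hpt : ∀ η, |G t η| ≤ C * t ^ m * Real.exp (-(b * t * ‖η‖ ^ 2)) := by
    intro η
    rcases le_or_gt ‖η‖ R with hη | hη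
    · have := hB 0 (by simp) t ht η hη
      rwa [mul_right_comm b] at this
    · rw [h0 t η hη, abs_zero]
      positivity
  have hsq : ∀ η, G t η ^ 2 ≤ C ^ 2 * t ^ (2 * m) * Real.exp (-(b * t * ‖η‖ ^ 2)) := by
    intro η
    rw [← sq_abs]
    calc |G t η| ^ 2 ≤ (C * t ^ m * Real.exp (-(b * t * ‖η‖ ^ 2))) ^ 2 := by
          gcongr
          exact hpt η
      _ = C ^ 2 * t ^ (2 * m) * (Real.exp (-(b * t * ‖η‖ ^ 2)) * Real.exp (-(b * t * ‖η‖ ^ 2))) := by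
        rw [two_mul m, Real.rpow_add ht0]
        ring
      _ ≤ C ^ 2 * t ^ (2 * m) * (1 * Real.exp (-(b * t * ‖η‖ ^ 2))) := by
        gcongr
        rw [Real.exp_le_one_iff]
        have : 0 ≤ b * t * ‖η‖ ^ 2 := by positivity
        linarith
      _ = _ := by ring
  have hi := integrable_gaussian hbt
  have e : ∀ r : ℝ, t ^ r * (Real.pi / (b * t)) = Real.pi / b * t ^ (r - 1) := fun r => by
    rw [Real.rpow_sub_one ht0.ne']
    field_simp
  constructor
  · calc ∫ η, |G t η| ≤ ∫ η, C * t ^ m * Real.exp (-(b * t * ‖η‖ ^ 2)) :=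
          integral_mono_of_nonneg (Eventually.of_forall fun _ => abs_nonneg _) (hi.const_mul _)
            (Eventually.of_forall hpt)
      _ = C * (Real.pi / b) * t ^ (m - 1) := by
        rw [integral_const_mul, integral_gaussian_plane hbt, mul_assoc, e, mul_assoc]
      _ ≤ _ := by
        gcongr
        have : 0 < C ^ 2 * (Real.pi / b) := by positivity
        linarith
  · calc ∫ η, G t η ^ 2 ≤ ∫ η, C ^ 2 * t ^ (2 * m) * Real.exp (-(b * t * ‖η‖ ^ 2)) :=
          integral_mono_of_nonneg (Eventually.of_forall fun _ => sq_nonneg _) (hi.const_mul _)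
            (Eventually.of_forall hsq)
      _ = C ^ 2 * (Real.pi / b) * t ^ (2 * m - 1) := by
        rw [integral_const_mul, integral_gaussian_plane hbt, mul_assoc, e, mul_assoc]
      _ ≤ _ := by
        gcongr
        have : 0 < C * (Real.pi / b) := by positivity
        linarith

/-- The weight `1 + ((|x|² - L)/T)²` has an inverse of integral `O(T)`, uniformly in `L`: in polar
coordinates the radial integrand is the derivative of `(T/2) arctan ((r² - L)/T)`. -/
theorem integral_inv_coneWeight_le {L T : ℝ} (hT : 0 < T) :
    Integrable (fun x : Plane => (1 + ((‖x‖ ^ 2 - L) / T) ^ 2)⁻¹) ∧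
      ∫ x : Plane, (1 + ((‖x‖ ^ 2 - L) / T) ^ 2)⁻¹ ≤
        2 * (volume.real (Metric.ball (0 : Plane) 1) * (T * Real.pi)) := by
  set g : ℝ → ℝ := fun r => T / 2 * Real.arctan ((r ^ 2 - L) / T) with hg
  have hd : ∀ r ∈ Set.Ici (0 : ℝ), HasDerivAt g (r * (1 + ((r ^ 2 - L) / T) ^ 2)⁻¹) r := by
    intro r _
    have h1 : HasDerivAt (fun r : ℝ => (r ^ 2 - L) / T) (2 * r / T) r := by
      simpa using (((hasDerivAt_pow 2 r).sub_const L).div_const T)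
    refine HasDerivAt.congr_deriv (h1.arctan.const_mul (T / 2)) ?_
    field_simp
  have hpos : ∀ r ∈ Set.Ioi (0 : ℝ), 0 ≤ r * (1 + ((r ^ 2 - L) / T) ^ 2)⁻¹ := fun r hr => by
    have : 0 < r := hr
    positivity
  have hlim : Tendsto g atTop (𝓝 (T / 2 * (Real.pi / 2))) := by
    have h1 : Tendsto (fun r : ℝ => (r ^ 2 - L) / T) atTop atTop :=
      (tendsto_atTop_add_const_right _ (-L) (tendsto_pow_atTop two_ne_zero)).atTop_div_const hT
    exact ((Real.tendsto_arctan_atTop.mono_right nhdsWithin_le_nhds).comp h1).const_mul _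
  have hint := integrableOn_Ioi_deriv_of_nonneg' hd hpos hlim
  have hval := integral_Ioi_of_hasDerivAt_of_nonneg' hd hpos hlim
  refine ⟨?_, ?_⟩
  · refine (integrable_fun_norm_addHaar (volume : Measure Plane)
      (f := fun r : ℝ => (1 + ((r ^ 2 - L) / T) ^ 2)⁻¹)).2 ?_
    rw [finrank_euclideanSpace_fin]
    simpa using hint
  · have h := integral_fun_norm_addHaar (volume : Measure Plane)
      (fun r : ℝ => (1 + ((r ^ 2 - L) / T) ^ 2)⁻¹)
    rw [finrank_euclideanSpace_fin] at h
    simp only [Nat.add_one_sub_one, pow_one, smul_eq_mul, nsmul_eq_mul, Nat.cast_ofNat] at h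
    rw [h, hval]
    gcongr
    have := Real.neg_pi_div_two_lt_arctan ((0 ^ 2 - L) / T)
    rw [hg]
    nlinarith [Real.pi_pos]

/-- Cauchy-Schwarz against the weight `1 + ((|x|² - L)/T)²`, in the form of the arithmetic-geometric
mean inequality with a free parameter `ε`. -/
theorem integral_norm_le_of_coneWeight {f h : Plane → ℂ} {L T ε : ℝ} (hT : 0 < T) (hε : 0 < ε)
    (hf : Integrable fun x => ‖f x‖ ^ 2) (hh : Integrable fun x => ‖h x‖ ^ 2)
    (e : ∀ x, h x = ((L - ‖x‖ ^ 2 : ℝ) : ℂ) * f x) :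
    ∫ x, ‖f x‖ ≤ ε * (2 * (volume.real (Metric.ball (0 : Plane) 1) * (T * Real.pi)))
      + ε⁻¹ * (∫ x, ‖f x‖ ^ 2 + (T ^ 2)⁻¹ * ‖h x‖ ^ 2) := by
  obtain ⟨hw, hw'⟩ := integral_inv_coneWeight_le (L := L) hT
  have hpt : ∀ x, ‖f x‖ ≤ ε * (1 + ((‖x‖ ^ 2 - L) / T) ^ 2)⁻¹
      + ε⁻¹ * (‖f x‖ ^ 2 + (T ^ 2)⁻¹ * ‖h x‖ ^ 2) := by
    intro x
    have e1 : ‖f x‖ ^ 2 + (T ^ 2)⁻¹ * ‖h x‖ ^ 2 = (1 + ((‖x‖ ^ 2 - L) / T) ^ 2) * ‖f x‖ ^ 2 := by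
      rw [e, norm_mul, Complex.norm_real, Real.norm_eq_abs, mul_pow, sq_abs]
      field_simp
      ring
    rw [e1]
    set w := 1 + ((‖x‖ ^ 2 - L) / T) ^ 2
    have hwpos : 0 < w := by positivity
    set a := ‖f x‖
    have ha : 0 ≤ a := norm_nonneg _
    have e2 : ε * w⁻¹ + ε⁻¹ * (w * a ^ 2) - 2 * a = (ε - w * a) ^ 2 / (ε * w) := by
      field_simp
      ring
    have : 0 ≤ (ε - w * a) ^ 2 / (ε * w) := by positivity
    linarith
  have hi1 := hw.const_mul ε
  have hi2 := (hf.add (hh.const_mul (T ^ 2)⁻¹)).const_mul ε⁻¹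
  calc ∫ x, ‖f x‖ ≤ ∫ x, (ε * (1 + ((‖x‖ ^ 2 - L) / T) ^ 2)⁻¹
        + ε⁻¹ * (‖f x‖ ^ 2 + (T ^ 2)⁻¹ * ‖h x‖ ^ 2)) :=
        integral_mono_of_nonneg (Eventually.of_forall fun _ => norm_nonneg _) (hi1.add hi2)
          (Eventually.of_forall hpt)
    _ = ε * (∫ x : Plane, (1 + ((‖x‖ ^ 2 - L) / T) ^ 2)⁻¹)
        + ε⁻¹ * (∫ x, ‖f x‖ ^ 2 + (T ^ 2)⁻¹ * ‖h x‖ ^ 2) := by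
      rw [← integral_const_mul, ← integral_const_mul]
      exact integral_add hi1 hi2
    _ ≤ _ := by gcongr

theorem ConeLocalized.hasCompactSupport {c R m : ℝ} {G : ℝ → Plane → ℝ}
    (hG : ConeLocalized c R m G) (t : ℝ) : HasCompactSupport (G t) := by
  refine HasCompactSupport.intro (isCompact_closedBall (0 : Plane) R) fun η hη => ?_
  rw [mem_closedBall_zero_iff, not_le] at hη
  exact hG.eq_zero t η hη.le

theorem contDiff_planeLaplacian {G : Plane → ℝ} (hG : ContDiff ℝ ∞ G) :
    ContDiff ℝ ∞ (planeLaplacian G) := by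
  have := contDiff_realPartial (contDiff_realPartial hG 0) 0
  have h := this.add (contDiff_realPartial (contDiff_realPartial hG 1) 1)
  have e : planeLaplacian G = fun η =>
      realPartial 0 (realPartial 0 G) η + realPartial 1 (realPartial 1 G) η :=
    funext fun η => Fin.sum_univ_two _
  rwa [e]

theorem hasCompactSupport_planeLaplacian {G : Plane → ℝ} (hs : HasCompactSupport G) :
    HasCompactSupport (planeLaplacian G) := by
  have h := (hasCompactSupport_realPartial (hasCompactSupport_realPartial hs 0) 0).add
    (hasCompactSupport_realPartial (hasCompactSupport_realPartial hs 1) 1)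
  have e : planeLaplacian G = realPartial 0 (realPartial 0 G) + realPartial 1 (realPartial 1 G) :=
    funext fun η => Fin.sum_univ_two _
  rwa [e]

theorem realPartial_eq_zero {R : ℝ} {f : Plane → ℝ} (hf : ∀ η, R < ‖η‖ → f η = 0) (j : Fin 2)
    {η : Plane} (hη : R < ‖η‖) : realPartial j f η = 0 := by
  have h : f =ᶠ[𝓝 η] fun _ => 0 := by
    filter_upwards [(isOpen_lt continuous_const continuous_norm).mem_nhds hη] with ξ hξ
    exact hf ξ hξ
  rw [realPartial, h.fderiv_eq]
  simp

/-- The `L∞`, `L²` and `L¹` bounds of the kernels of a cone-localized family. The loss `t^(3/4)` from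
`L²` to `L¹` is the square root of the area of an annulus of radius `c t` and width `√t`. -/
theorem ConeLocalized.exists_norm_le {c R m : ℝ} {G : ℝ → Plane → ℝ}
    (hG : ConeLocalized c R m G) :
    ∃ K : ℝ, 1 ≤ K ∧ ∀ t : ℝ, 1 ≤ t →
      (∀ x, ‖invFourier (fun η => (G t η : ℂ)) x‖ ≤ K * t ^ (m - 1)) ∧
      ∫ x, ‖invFourier (fun η => (G t η : ℂ)) x‖ ^ 2 ≤ K * t ^ (2 * m - 1) ∧
      ∫ x, ‖invFourier (fun η => (G t η : ℂ)) x‖ ≤ K * t ^ (m + 1 / 4) := by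
  have hz : ∀ t η, R < ‖η‖ → G t η = 0 := fun t η hη => hG.eq_zero t η hη.le
  obtain ⟨K₁, hK₁, h₁⟩ := hG.bound.exists_integral_le hz
  obtain ⟨K₂, hK₂, h₂⟩ := hG.bound_wave.exists_integral_le fun t η hη => by
    have h2 : ∀ j, realPartial j (realPartial j (G t)) η = 0 := fun j =>
      realPartial_eq_zero (fun _ hξ => realPartial_eq_zero (hz t) j hξ) j hη
    simp [planeLaplacian, h2, hz t η hη]
  set V := volume.real (Metric.ball (0 : Plane) 1) with hV
  have hV0 : 0 ≤ V := measureReal_nonneg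
  refine ⟨1 + K₁ + (2 * (V * Real.pi) + (K₁ + K₂)), by have := Real.pi_pos
                                                       have : 0 ≤ V * Real.pi := by positivity
                                                       linarith, fun t ht => ?_⟩
  have ht0 : 0 < t := by linarith
  have hVpi : 0 ≤ V * Real.pi := by positivity
  have hs := hG.hasCompactSupport t
  have hL2 : ∫ x, ‖invFourier (fun η => (G t η : ℂ)) x‖ ^ 2 ≤ K₁ * t ^ (2 * m - 1) :=
    (integral_norm_sq_invFourier_le (hG.smooth t) hs).trans (h₁ t ht).2
  refine ⟨fun x => ?_, ?_, ?_⟩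
  · calc _ ≤ ∫ η, ‖(G t η : ℂ)‖ := norm_invFourier_le _ x
      _ = ∫ η, |G t η| := by simp only [Complex.norm_real, Real.norm_eq_abs]
      _ ≤ K₁ * t ^ (m - 1) := (h₁ t ht).1
      _ ≤ _ := by gcongr; linarith
  · refine hL2.trans ?_
    gcongr
    linarith
  · set H : Plane → ℝ := fun η => planeLaplacian (G t) η + c ^ 2 * t ^ 2 * G t η with hH
    have hHs : ContDiff ℝ ∞ H :=
      (contDiff_planeLaplacian (hG.smooth t)).add (contDiff_const.mul (hG.smooth t))
    have hHc : HasCompactSupport H :=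
      (hasCompactSupport_planeLaplacian hs).add (hs.mul_left (f := fun _ => c ^ 2 * t ^ 2))
    have hw2 : ∫ x, ‖invFourier (fun η => (H η : ℂ)) x‖ ^ 2 ≤ K₂ * t ^ (2 * (m + 3 / 2) - 1) :=
      (integral_norm_sq_invFourier_le hHs hHc).trans (h₂ t ht).2
    have hi := integrable_norm_sq_invFourier (hG.smooth t) hs
    have hiH := integrable_norm_sq_invFourier hHs hHc
    -- this `ε` gives both terms of the Cauchy-Schwarz bound the rate `t^(m + 1/4)`
    have hmain := integral_norm_le_of_coneWeight (T := t ^ (3 / 2 : ℝ)) (ε := t ^ (m - 5 / 4))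
      (by positivity) (by positivity) hi hiH
      (invFourier_laplacian_add (hG.smooth t) hs (c ^ 2 * t ^ 2))
    rw [integral_add hi (hiH.const_mul _), integral_const_mul] at hmain
    refine hmain.trans ?_
    have eT : ((t ^ (3 / 2 : ℝ)) ^ 2)⁻¹ = t ^ (-3 : ℝ) := by
      rw [← Real.rpow_natCast, ← Real.rpow_mul ht0.le, ← Real.rpow_neg ht0.le]
      norm_num
    have eε : (t ^ (m - 5 / 4))⁻¹ = t ^ (5 / 4 - m) := by
      rw [← Real.rpow_neg ht0.le, neg_sub]
    rw [eT, eε]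
    calc _ ≤ t ^ (m - 5 / 4) * (2 * (V * (t ^ (3 / 2 : ℝ) * Real.pi)))
          + t ^ (5 / 4 - m) * (K₁ * t ^ (2 * m - 1)
            + t ^ (-3 : ℝ) * (K₂ * t ^ (2 * (m + 3 / 2) - 1))) := by gcongr
      _ = 2 * (V * Real.pi) * (t ^ (m - 5 / 4) * t ^ (3 / 2 : ℝ))
          + K₁ * (t ^ (5 / 4 - m) * t ^ (2 * m - 1))
          + K₂ * (t ^ (5 / 4 - m) * t ^ (-3 : ℝ) * t ^ (2 * (m + 3 / 2) - 1)) := by ring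
      _ = (2 * (V * Real.pi) + (K₁ + K₂)) * t ^ (m + 1 / 4) := by
        rw [← Real.rpow_add ht0, ← Real.rpow_add ht0, ← Real.rpow_add ht0, ← Real.rpow_add ht0]
        ring_nf
      _ ≤ _ := mul_le_mul_of_nonneg_right (by linarith) (by positivity)

theorem eLpNorm_le_ofReal_of_pow_le {f : Plane → ℂ} {p : ℝ≥0∞} (hp0 : p ≠ 0) (hp : p ≠ ⊤)
    {h : Plane → ℝ} (hh : Integrable h) (hfh : ∀ x, ‖f x‖ ^ p.toReal ≤ h x) {M : ℝ} (hM : 0 ≤ M)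
    (hint : ∫ x, h x ≤ M ^ p.toReal) : eLpNorm f p volume ≤ ENNReal.ofReal M := by
  have hp' : 0 < p.toReal := ENNReal.toReal_pos hp0 hp
  rw [eLpNorm_eq_lintegral_rpow_enorm_toReal hp0 hp, one_div, ENNReal.rpow_inv_le_iff hp',
    ENNReal.ofReal_rpow_of_nonneg hM hp'.le]
  calc ∫⁻ x, ‖f x‖ₑ ^ p.toReal ≤ ∫⁻ x, ENNReal.ofReal (h x) := by
        refine lintegral_mono fun x => ?_
        rw [← ofReal_norm, ENNReal.ofReal_rpow_of_nonneg (norm_nonneg _) hp'.le]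
        exact ENNReal.ofReal_le_ofReal (hfh x)
    _ = ENNReal.ofReal (∫ x, h x) :=
      (ofReal_integral_eq_lintegral_ofReal hh
        (Eventually.of_forall fun x => le_trans (by positivity) (hfh x))).symm
    _ ≤ _ := ENNReal.ofReal_le_ofReal hint

/-- Interpolation between `L²` and `L∞` at the rates `t^(m - 1/2)` and `t^(m - 1)`. -/
theorem eLpNorm_le_of_two_le {f : Plane → ℂ} {K t m : ℝ} (hK : 1 ≤ K) (ht : 1 ≤ t)
    (hf2 : Integrable fun x => ‖f x‖ ^ 2)
    (hinf : ∀ x, ‖f x‖ ≤ K * t ^ (m - 1)) (h2 : ∫ x, ‖f x‖ ^ 2 ≤ K * t ^ (2 * m - 1))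
    {p : ℝ≥0∞} (hp : 2 ≤ p) :
    eLpNorm f p volume ≤ ENNReal.ofReal (K * t ^ (m - 1 + (p⁻¹).toReal)) := by
  have ht0 : 0 < t := by linarith
  have hK0 : 0 < K := by linarith
  rcases eq_or_ne p ⊤ with rfl | hpt
  · rw [eLpNorm_exponent_top]
    refine (eLpNormEssSup_le_of_ae_bound (Eventually.of_forall hinf)).trans_eq ?_
    simp
  · have hp0 : p ≠ 0 := by
      rintro rfl
      simp at hp
    have hq : 2 ≤ p.toReal := by
      rw [← ENNReal.toReal_ofNat 2]
      exact (ENNReal.toReal_le_toReal (by simp) hpt).2 hp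
    rw [ENNReal.toReal_inv]
    set q := p.toReal with hqdef
    have hq0 : 0 < q := by linarith
    refine eLpNorm_le_ofReal_of_pow_le hp0 hpt (hf2.const_mul ((K * t ^ (m - 1)) ^ (q - 2)))
      (fun x => ?_) (by positivity) ?_
    · calc ‖f x‖ ^ q = ‖f x‖ ^ (q - 2) * ‖f x‖ ^ 2 := by
            rw [← Real.rpow_natCast, ← Real.rpow_add_of_nonneg (norm_nonneg _) (by linarith)
              (by norm_num)]
            norm_num
        _ ≤ _ := by
          gcongr
          exacts [hinf x]
    · rw [integral_const_mul]
      calc (K * t ^ (m - 1)) ^ (q - 2) * ∫ x, ‖f x‖ ^ 2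
          ≤ (K * t ^ (m - 1)) ^ (q - 2) * (K * t ^ (2 * m - 1)) := by gcongr
        _ = (K ^ (q - 2) * K) * (t ^ ((m - 1) * (q - 2)) * t ^ (2 * m - 1)) := by
          rw [Real.mul_rpow hK0.le (by positivity), ← Real.rpow_mul ht0.le]
          ring
        _ = K ^ (q - 1) * t ^ ((m - 1 + q⁻¹) * q) := by
          rw [← Real.rpow_add_one hK0.ne', ← Real.rpow_add ht0]
          congr 2
          · ring
          · field_simp
            ring
        _ ≤ K ^ q * t ^ ((m - 1 + q⁻¹) * q) := by
          gcongr
          linarith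
        _ = _ := by rw [Real.mul_rpow hK0.le (by positivity), ← Real.rpow_mul ht0.le]

/-- Interpolation between `L¹` and `L²` at the rates `t^(m + 1/4)` and `t^(m - 1/2)`. -/
theorem eLpNorm_le_of_le_two {f : Plane → ℂ} {K t m : ℝ} (hK : 1 ≤ K) (ht : 1 ≤ t)
    (hf : Integrable f) (hf2 : Integrable fun x => ‖f x‖ ^ 2)
    (h2 : ∫ x, ‖f x‖ ^ 2 ≤ K * t ^ (2 * m - 1)) (h1 : ∫ x, ‖f x‖ ≤ K * t ^ (m + 1 / 4))
    {p : ℝ≥0∞} (hp1 : 1 ≤ p) (hp2 : p ≤ 2) :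
    eLpNorm f p volume ≤ ENNReal.ofReal (2 * K * t ^ (m - 5 / 4 + 3 / 2 * (p⁻¹).toReal)) := by
  have ht0 : 0 < t := by linarith
  have hK0 : 0 < K := by linarith
  have hpt : p ≠ ⊤ := ne_top_of_le_ne_top (by simp) hp2
  have hp0 : p ≠ 0 := by
    rintro rfl
    simp at hp1
  have hq2 : p.toReal ≤ 2 := by
    rw [← ENNReal.toReal_ofNat 2]
    exact (ENNReal.toReal_le_toReal hpt (by simp)).2 hp2
  have hq1 : 1 ≤ p.toReal := by
    rw [← ENNReal.toReal_one]
    exact (ENNReal.toReal_le_toReal (by simp) hpt).2 hp1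
  rw [ENNReal.toReal_inv]
  set q := p.toReal with hqdef
  have hq0 : 0 < q := by linarith
  -- the level at which `α⁻¹ |f|²` and `|f|` have integrals of the same order
  set α : ℝ := t ^ (m - 5 / 4) with hα
  have hα0 : 0 < α := by positivity
  refine eLpNorm_le_ofReal_of_pow_le hp0 hpt
    ((hf.norm.const_mul (α ^ (q - 1))).add (hf2.const_mul (α ^ (q - 2))))
    (fun x => ?_) (by positivity) ?_
  · simp only [Pi.add_apply]
    set a := ‖f x‖
    have ha : 0 ≤ a := norm_nonneg _
    rcases le_total a α with h | h
    · have : a ^ q ≤ α ^ (q - 1) * a := by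
        calc a ^ q = a ^ (q - 1) * a := by
              rw [← Real.rpow_add_one' ha (by linarith)]
              norm_num
          _ ≤ _ := by gcongr
      have h' : 0 ≤ α ^ (q - 2) * a ^ 2 := by positivity
      linarith
    · have ha0 : 0 < a := by linarith
      have : a ^ q ≤ α ^ (q - 2) * a ^ 2 := by
        calc a ^ q = a ^ (q - 2) * a ^ 2 := by
              rw [← Real.rpow_natCast, ← Real.rpow_add ha0]
              norm_num
          _ ≤ _ := by
            exact mul_le_mul_of_nonneg_right
              (Real.rpow_le_rpow_of_nonpos hα0 h (by linarith)) (by positivity)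
      have : 0 ≤ α ^ (q - 1) * a := by positivity
      linarith
  · have hsum := integral_add (hf.norm.const_mul (α ^ (q - 1))) (hf2.const_mul (α ^ (q - 2)))
    have e : ∀ r : ℝ, α ^ r = t ^ ((m - 5 / 4) * r) := fun r => by
      rw [hα, ← Real.rpow_mul ht0.le]
    calc _ = α ^ (q - 1) * (∫ x, ‖f x‖) + α ^ (q - 2) * (∫ x, ‖f x‖ ^ 2) := by
          rw [← integral_const_mul, ← integral_const_mul]
          exact hsum
      _ ≤ α ^ (q - 1) * (K * t ^ (m + 1 / 4)) + α ^ (q - 2) * (K * t ^ (2 * m - 1)) := by gcongr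
      _ = K * (t ^ ((m - 5 / 4) * (q - 1)) * t ^ (m + 1 / 4))
          + K * (t ^ ((m - 5 / 4) * (q - 2)) * t ^ (2 * m - 1)) := by
        rw [e, e]
        ring
      _ = 2 * K * t ^ ((m - 5 / 4 + 3 / 2 * q⁻¹) * q) := by
        rw [← Real.rpow_add ht0, ← Real.rpow_add ht0]
        have e1 : (m - 5 / 4) * (q - 1) + (m + 1 / 4) = (m - 5 / 4 + 3 / 2 * q⁻¹) * q := by
          field_simp
          ring
        have e2 : (m - 5 / 4) * (q - 2) + (2 * m - 1) = (m - 5 / 4 + 3 / 2 * q⁻¹) * q := by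
          field_simp
          ring
        rw [e1, e2]
        ring
      _ ≤ (2 * K) ^ q * t ^ ((m - 5 / 4 + 3 / 2 * q⁻¹) * q) := by
        gcongr
        exact Real.self_le_rpow_of_one_le (by linarith) hq1
      _ = _ := by rw [Real.rpow_mul ht0.le, ← Real.mul_rpow (by positivity) (by positivity)]

/-! ### The difference of the two symbols -/

/-- The symbol interpolating between the artificial viscosity system (`s = 0`) and the curl-free
system (`s = 1`), written with entire functions so that it is smooth in `η`, in particular at the
removable singularities of `curlFreeSymbol` and `artificialSymbol`. -/
noncomputable def regularSymbol (c ν s t : ℝ) (η : Plane) : Matrix StateIdx StateIdx ℂ :=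
  blockSymbol
    ((dampedCos c ν 0 0 s t (‖η‖ ^ 2)
      - s * ν * (‖η‖ ^ 2 * dampedCos c ν 1 1 s t (‖η‖ ^ 2)) : ℝ) : ℂ)
    (Complex.I * ((-2 * dampedCos c ν 1 1 s t (‖η‖ ^ 2) : ℝ) : ℂ))
    (Complex.I * (c : ℂ) ^ 2 * ((-2 * dampedCos c ν 1 1 s t (‖η‖ ^ 2) : ℝ) : ℂ))
    ((dampedCos c ν 0 0 s t (‖η‖ ^ 2)
      + s * ν * (‖η‖ ^ 2 * dampedCos c ν 1 1 s t (‖η‖ ^ 2)) : ℝ) : ℂ) η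

theorem eigPlus_sub_eigMinus (c ν : ℝ) (η : Plane) :
    eigPlus c ν η - eigMinus c ν η = discRoot c ν η := by
  simp only [eigPlus, eigMinus]
  ring

theorem discRoot_sq (c ν : ℝ) (η : Plane) :
    discRoot c ν η ^ 2 = -4 * ((freqSq c ν 1 (‖η‖ ^ 2) : ℝ) : ℂ) := by
  obtain ⟨h1, h2⟩ := eig_root c ν η
  rw [← eigPlus_sub_eigMinus, freqSq]
  push_cast
  linear_combination (eigPlus c ν η + eigMinus c ν η - (ν : ℂ) * (‖η‖ : ℂ) ^ 2) * h1 - 4 * h2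

theorem curlFreeSymbol_eq_regularSymbol {c ν : ℝ} (t : ℝ) {η : Plane} (h : discRoot c ν η ≠ 0) :
    curlFreeSymbol c ν t η = regularSymbol c ν 1 t η := by
  set d := discRoot c ν η with hd
  set q := freqSq c ν 1 (‖η‖ ^ 2) with hq
  set E : ℂ := Complex.exp (-((ν : ℂ) / 2 * (‖η‖ : ℂ) ^ 2 * t)) with hE
  have hζ : (d * t / 2) ^ 2 = -((q * t ^ 2 : ℝ) : ℂ) := by
    have := discRoot_sq c ν η
    push_cast
    linear_combination (t : ℂ) ^ 2 / 4 * this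
  have hsinh := sinh_eq_cosSqrt hζ
  have hcosh := cosh_eq_cosSqrt hζ
  have hp : Complex.exp (eigPlus c ν η * t) =
      E * (Complex.cosh (d * t / 2) + Complex.sinh (d * t / 2)) := by
    rw [Complex.cosh_add_sinh, hE, ← Complex.exp_add, eigPlus]
    congr 1
    ring
  have hm : Complex.exp (eigMinus c ν η * t) =
      E * (Complex.cosh (d * t / 2) - Complex.sinh (d * t / 2)) := by
    rw [Complex.cosh_sub_sinh, hE, ← Complex.exp_add, eigMinus]
    congr 1
    ring
  have hER : E = ((Real.exp (-(ν / 2 * ‖η‖ ^ 2 * t)) : ℝ) : ℂ) := by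
    rw [hE]
    push_cast
    rfl
  simp only [curlFreeSymbol, regularSymbol]
  rw [eigPlus_sub_eigMinus, hp, hm, hcosh, hsinh]
  simp only [dampedCos, ← hq, eigPlus, eigMinus, ← hd]
  push_cast at hER ⊢
  rw [← hER]
  congr 1
  · field_simp
    ring
  · field_simp
    ring
  · field_simp
    ring
  · field_simp
    ring

theorem artificialSymbol_eq_regularSymbol {c ν : ℝ} (hc : 0 < c) (t : ℝ) {η : Plane} (h : η ≠ 0) :
    artificialSymbol c ν t η = regularSymbol c ν 0 t η := by
  have hn : ‖η‖ ≠ 0 := norm_ne_zero_iff.2 h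
  have hq : freqSq c ν 0 (‖η‖ ^ 2) * t ^ 2 = (c * ‖η‖ * t) ^ 2 := by
    rw [freqSq]
    ring
  have hs : waveSymbol c t η = -2 * t * cosSqrt 1 ((c * ‖η‖ * t) ^ 2) := by
    have := mul_cosSqrt_one_sq (c * ‖η‖ * t)
    rw [waveSymbol, div_eq_iff (by positivity)]
    linear_combination 2 * this
  have e1 : waveDerivSymbol c t η * heatSymbol (ν / 2) t η =
      dampedCos c ν 0 0 0 t (‖η‖ ^ 2) := by
    rw [dampedCos, hq, cosSqrt_zero_sq, waveDerivSymbol, heatSymbol]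
    ring
  have e2 : waveSymbol c t η * heatSymbol (ν / 2) t η =
      -2 * dampedCos c ν 1 1 0 t (‖η‖ ^ 2) := by
    rw [dampedCos, hq, hs, heatSymbol]
    ring
  rw [artificialSymbol, regularSymbol, e1, e2]
  simp

theorem ae_ne_zero_and_discRoot_ne_zero {c ν : ℝ} (hν : 0 < ν) :
    ∀ᵐ η : Plane, η ≠ 0 ∧ discRoot c ν η ≠ 0 := by
  have h0 : ∀ᵐ η : Plane, η ∉ Metric.sphere (0 : Plane) 0 :=
    measure_eq_zero_iff_ae_notMem.1 (Measure.addHaar_sphere volume 0 0)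
  have h1 : ∀ᵐ η : Plane, η ∉ Metric.sphere (0 : Plane) |2 * c / ν| :=
    measure_eq_zero_iff_ae_notMem.1 (Measure.addHaar_sphere volume 0 _)
  filter_upwards [h0, h1] with η hη0 hη1
  rw [mem_sphere_zero_iff_norm] at hη0 hη1
  refine ⟨norm_ne_zero_iff.1 hη0, fun hd => hη1 ?_⟩
  have h := discRoot_sq c ν η
  rw [hd] at h
  have h2 : freqSq c ν 1 (‖η‖ ^ 2) = 0 := by
    have : ((freqSq c ν 1 (‖η‖ ^ 2) : ℝ) : ℂ) = 0 := by linear_combination 1 / 4 * h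
    exact_mod_cast this
  rw [freqSq] at h2
  have h3 : ‖η‖ ^ 2 * (‖η‖ ^ 2 - (2 * c / ν) ^ 2) = 0 := by
    field_simp
    linear_combination -4 * h2
  have h4 : ‖η‖ ^ 2 = (2 * c / ν) ^ 2 := by
    rcases mul_eq_zero.1 h3 with h | h
    · exact absurd (pow_eq_zero_iff two_ne_zero |>.1 h) hη0
    · linarith
  rw [← abs_of_nonneg (norm_nonneg η)]
  exact (sq_eq_sq_iff_abs_eq_abs _ _).1 h4

theorem continuous_regularSymbol (c ν s t : ℝ) (i j : StateIdx) :
    Continuous fun η => regularSymbol c ν s t η i j := by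
  have hd : ∀ n k, Continuous fun η : Plane => dampedCos c ν n k s t (‖η‖ ^ 2) := fun n k =>
    (contDiff_radial (contDiff_dampedCos c ν n k s t)).continuous
  have h00 := hd 0 0
  have h11 := hd 1 1
  have hx : ∀ i, Continuous fun η : Plane => η i := fun i => (contDiff_coord i).continuous
  rcases i with i | i <;> rcases j with j | j
  · simp only [regularSymbol, blockSymbol, Matrix.fromBlocks_apply₁₁, Matrix.of_apply]
    fun_prop
  · simp only [regularSymbol, blockSymbol, Matrix.fromBlocks_apply₁₂, Matrix.of_apply]
    have := hx j
    fun_prop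
  · simp only [regularSymbol, blockSymbol, Matrix.fromBlocks_apply₂₁, Matrix.of_apply]
    have := hx i
    fun_prop
  · simp only [regularSymbol, blockSymbol, Matrix.fromBlocks_apply₂₂, Matrix.smul_apply]
    fun_prop

theorem VanishesToOrder.coord_pow_mul {R : ℝ} {D : ℕ} {B : Plane → ℝ} (hB : VanishesToOrder R D B)
    (i : Fin 2) (n : ℕ) : VanishesToOrder R (D + n) fun η => η i ^ n * B η := by
  induction n with
  | zero => simpa using hB
  | succ n ih =>
    have h := ih.coord_mul i
    have e : (fun η : Plane => η i ^ (n + 1) * B η) = fun η => η i * (η i ^ n * B η) := by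
      funext η
      ring
    rw [e]
    exact h

theorem vanishesToOrder_monomial_mul {R : ℝ} {χ : Plane → ℝ} (hχ : ContDiff ℝ ∞ χ)
    (h0 : ∀ η, R ≤ ‖η‖ → χ η = 0) (σ : Fin 2 → ℕ) :
    VanishesToOrder R (multiLength σ) fun η => monomial σ η * χ η := by
  have h := ((VanishesToOrder.of_smooth hχ h0).coord_pow_mul 1 (σ 1)).coord_pow_mul 0 (σ 0)
  have e : (fun η => monomial σ η * χ η) = fun η : Plane => η 0 ^ σ 0 * (η 1 ^ σ 1 * χ η) := by
    funext η
    rw [monomial]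
    ring
  have e2 : multiLength σ = 0 + σ 1 + σ 0 := by
    rw [multiLength, Fin.sum_univ_two]
    ring
  rw [e, e2]
  exact h

/-- Every entry of the difference of the symbols, times a monomial and the cut-off, is a constant
multiple of a cone-localized family of order `-(1 + |σ|)/2`. -/
theorem exists_coneLocalized_regularSymbol_sub {c ν R : ℝ} (hc : 0 < c) (hν : 0 < ν) (hR : 0 < R)
    {χ : Plane → ℝ} (hχ : ContDiff ℝ ∞ χ) (h0 : ∀ η, R ≤ ‖η‖ → χ η = 0) (σ : Fin 2 → ℕ)
    (i j : StateIdx) :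
    ∃ (a : ℂ) (G : ℝ → Plane → ℝ), ConeLocalized c R (-(1 + multiLength σ) / 2) G ∧
      ∀ t η, (monomial σ η : ℂ) * ((χ η : ℂ) * regularSymbol c ν 1 t η i j
        - (χ η : ℂ) * regularSymbol c ν 0 t η i j) = a * G t η := by
  have hB := vanishesToOrder_monomial_mul hχ h0 σ
  set B : Plane → ℝ := fun η => monomial σ η * χ η with hBdef
  set m : ℝ := -(1 + multiLength σ) / 2 with hm
  have X1 := ConeLocalized.mul_dampedCos_sub (c := c) (ν := ν) hc hν hR 0 (k := 0) (by omega) hB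
  have X2 := ConeLocalized.mul_dampedCos (c := c) (ν := ν) hc hν hR 1 (k := 1) le_rfl (by omega)
    hB.normSq_mul
  have X3 := fun l => ConeLocalized.mul_dampedCos_sub (c := c) (ν := ν) hc hν hR 1 (k := 1)
    (by omega) (hB.coord_mul l)
  have e1 : ((0 : ℕ) : ℝ) - ((multiLength σ : ℝ) + ((0 : ℕ) : ℝ) + 1) / 2 = m := by
    rw [hm]; push_cast; ring
  have e2 : ((1 : ℕ) : ℝ) - (((multiLength σ + 2 : ℕ) : ℝ) + ((1 : ℕ) : ℝ)) / 2 = m := by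
    rw [hm]; push_cast; ring
  have e3 : ((1 : ℕ) : ℝ) - (((multiLength σ + 1 : ℕ) : ℝ) + ((1 : ℕ) : ℝ) + 1) / 2 = m := by
    rw [hm]; push_cast; ring
  rw [e1] at X1
  rw [e2] at X2
  simp only [e3] at X3
  rcases i with i | i <;> rcases j with j | j
  · refine ⟨1, _, X1.add (X2.const_mul (-ν)), fun t η => ?_⟩
    simp only [regularSymbol, blockSymbol, Matrix.fromBlocks_apply₁₁, Matrix.of_apply, hBdef]
    push_cast
    ring
  · refine ⟨-2 * Complex.I, _, X3 j, fun t η => ?_⟩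
    simp only [regularSymbol, blockSymbol, Matrix.fromBlocks_apply₁₂, Matrix.of_apply, hBdef]
    push_cast
    ring
  · refine ⟨-2 * Complex.I * (c : ℂ) ^ 2, _, X3 i, fun t η => ?_⟩
    simp only [regularSymbol, blockSymbol, Matrix.fromBlocks_apply₂₁, Matrix.of_apply, hBdef]
    push_cast
    ring
  · refine ⟨(1 : Matrix (Fin 2) (Fin 2) ℂ) i j, _, X1.add (X2.const_mul ν), fun t η => ?_⟩
    simp only [regularSymbol, blockSymbol, Matrix.fromBlocks_apply₂₂, Matrix.smul_apply, hBdef,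
      smul_eq_mul]
    push_cast
    ring

/-! ### Kernel bounds for the low-frequency parts -/

section LowFrequency

variable {c ν R₀ : ℝ} {χ : Plane → ℝ}

theorem IsCutoff.hasCompactSupport_mul (hχ : IsCutoff R₀ χ) (g : Plane → ℂ) :
    HasCompactSupport fun η => (χ η : ℂ) * g η := by
  refine HasCompactSupport.intro (isCompact_closedBall (0 : Plane) (R₀ + 1)) fun η hη => ?_
  rw [mem_closedBall_zero_iff, not_le] at hη
  rw [hχ.eq_zero η hη.le, Complex.ofReal_zero, zero_mul]

theorem IsCutoff.continuous_mul_regularSymbol (hχ : IsCutoff R₀ χ) (c ν s t : ℝ) (i j : StateIdx) :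
    Continuous fun η => (χ η : ℂ) * regularSymbol c ν s t η i j :=
  (Complex.continuous_ofReal.comp hχ.smooth.continuous).mul (continuous_regularSymbol c ν s t i j)

theorem curlFreeLF_entry (hν : 0 < ν) (t : ℝ) (i j : StateIdx) :
    (fun x => curlFreeLF c ν χ t x i j) =
      invFourier fun η => (χ η : ℂ) * regularSymbol c ν 1 t η i j := by
  refine invFourier_congr_ae (g := fun η => (χ η : ℂ) * curlFreeSymbol c ν t η i j) ?_
  filter_upwards [ae_ne_zero_and_discRoot_ne_zero (c := c) hν] with η hη
  rw [curlFreeSymbol_eq_regularSymbol t hη.2]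

theorem artificialLF_entry (hc : 0 < c) (hν : 0 < ν) (t : ℝ) (i j : StateIdx) :
    (fun x => artificialLF c ν χ t x i j) =
      invFourier fun η => (χ η : ℂ) * regularSymbol c ν 0 t η i j := by
  refine invFourier_congr_ae (g := fun η => (χ η : ℂ) * artificialSymbol c ν t η i j) ?_
  filter_upwards [ae_ne_zero_and_discRoot_ne_zero (c := c) hν] with η hη
  rw [artificialSymbol_eq_regularSymbol hc t hη.1]

theorem multiDeriv_lowFreq_sub (hc : 0 < c) (hν : 0 < ν) (hχ : IsCutoff R₀ χ) (σ : Fin 2 → ℕ)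
    (t : ℝ) (i j : StateIdx) :
    multiDeriv σ (fun x => (curlFreeLF c ν χ t x - artificialLF c ν χ t x) i j) =
      invFourier fun η => (-Complex.I) ^ multiLength σ * ((monomial σ η : ℂ) *
        ((χ η : ℂ) * regularSymbol c ν 1 t η i j - (χ η : ℂ) * regularSymbol c ν 0 t η i j)) := by
  have hk := fun s => hχ.continuous_mul_regularSymbol c ν s t i j
  have hs := fun s => hχ.hasCompactSupport_mul fun η => regularSymbol c ν s t η i j
  have e : (fun x => (curlFreeLF c ν χ t x - artificialLF c ν χ t x) i j) =
      invFourier fun η =>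
        (χ η : ℂ) * regularSymbol c ν 1 t η i j - (χ η : ℂ) * regularSymbol c ν 0 t η i j := by
    funext x
    rw [invFourier_sub ((hk 1).integrable_of_hasCompactSupport (hs 1))
      ((hk 0).integrable_of_hasCompactSupport (hs 0)), ← curlFreeLF_entry hν,
      ← artificialLF_entry hc hν]
    rfl
  rw [e]
  have hs' := hχ.hasCompactSupport_mul fun η =>
    regularSymbol c ν 1 t η i j - regularSymbol c ν 0 t η i j
  simp only [mul_sub] at hs'
  exact multiDeriv_invFourier ((hk 1).sub (hk 0)) hs' σ

/-- The `L∞`, `L²` and `L¹` rates of `D^σ` of one entry of the difference, with `m = -(1 + |σ|)/2`. -/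
theorem exists_kernel_bound (hc : 0 < c) (hν : 0 < ν) (hR₀ : 0 < R₀) (hχ : IsCutoff R₀ χ)
    (σ : Fin 2 → ℕ) (i j : StateIdx) :
    ∃ K : ℝ, 1 ≤ K ∧ ∀ t : ℝ, 1 ≤ t → ∀ f : Plane → ℂ,
      f = multiDeriv σ (fun x => (curlFreeLF c ν χ t x - artificialLF c ν χ t x) i j) →
      Integrable f ∧ Integrable (fun x => ‖f x‖ ^ 2) ∧
      (∀ x, ‖f x‖ ≤ K * t ^ (-(1 + multiLength σ : ℝ) / 2 - 1)) ∧
      ∫ x, ‖f x‖ ^ 2 ≤ K * t ^ (2 * (-(1 + multiLength σ : ℝ) / 2) - 1) ∧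
      ∫ x, ‖f x‖ ≤ K * t ^ (-(1 + multiLength σ : ℝ) / 2 + 1 / 4) := by
  obtain ⟨a, G, hG, hGe⟩ := exists_coneLocalized_regularSymbol_sub hc hν
    (by linarith : 0 < R₀ + 1) hχ.smooth hχ.eq_zero σ i j
  obtain ⟨K, hK, hb⟩ := hG.exists_norm_le
  have hK0 : 0 < K := by linarith
  refine ⟨(1 + ‖a‖) ^ 2 * K, ?_, fun t ht f hf => ?_⟩
  · nlinarith [norm_nonneg a]
  have ht0 : 0 < t := by linarith
  have hfa : f = fun x => (-Complex.I) ^ multiLength σ * a * invFourier (fun η => (G t η : ℂ)) x := by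
    rw [hf, multiDeriv_lowFreq_sub hc hν hχ]
    funext x
    simp only [hGe, ← mul_assoc]
    rw [invFourier_const_mul]
  have hnorm : ∀ x, ‖f x‖ = ‖a‖ * ‖invFourier (fun η => (G t η : ℂ)) x‖ := fun x => by
    rw [hfa]
    simp
  have hcs := hG.hasCompactSupport t
  have a1 : ‖a‖ ≤ (1 + ‖a‖) ^ 2 := by nlinarith [norm_nonneg a]
  have a2 : ‖a‖ ^ 2 ≤ (1 + ‖a‖) ^ 2 := by nlinarith [norm_nonneg a]
  obtain ⟨b1, b2, b3⟩ := hb t ht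
  refine ⟨?_, ?_, fun x => ?_, ?_, ?_⟩
  · rw [hfa]
    exact (integrable_invFourier (hG.smooth t) hcs).const_mul _
  · simp only [hnorm, mul_pow]
    exact (integrable_norm_sq_invFourier (hG.smooth t) hcs).const_mul _
  · rw [hnorm, mul_assoc]
    exact mul_le_mul a1 (b1 x) (norm_nonneg _) (by positivity)
  · simp only [hnorm, mul_pow]
    rw [integral_const_mul, mul_assoc]
    exact mul_le_mul a2 b2 (integral_nonneg fun x => by positivity) (by positivity)
  · simp only [hnorm]
    rw [integral_const_mul, mul_assoc]
    exact mul_le_mul a1 b3 (integral_nonneg fun x => by positivity) (by positivity)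

theorem exists_entry_bound (K : StateIdx → StateIdx → ℝ) : ∃ C : ℝ, 0 < C ∧ ∀ i j, K i j ≤ C := by
  obtain ⟨C, hC⟩ := (Set.finite_range fun p : StateIdx × StateIdx => K p.1 p.2).bddAbove
  exact ⟨max C 1, by positivity, fun i j => (hC ⟨(i, j), rfl⟩).trans (le_max_left _ _)⟩

end LowFrequency

end ViscousFlow

theorem proposition1p4
    (c μ lam : ℝ) (hc : 0 < c) (hμ : 0 < μ) (hlam : 0 < lam + 2 * μ)
    (R₀ : ℝ) (hR₀ : 0 < R₀) (χ : ViscousFlow.Plane → ℝ) (hχ : ViscousFlow.IsCutoff R₀ χ) :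
    -- both low-frequency parts are smooth functions of the space variable
    (∀ t : ℝ, 1 ≤ t → ∀ i j : ViscousFlow.StateIdx,
      ContDiff ℝ ∞ (fun x => ViscousFlow.curlFreeLF c (lam + 2 * μ) χ t x i j) ∧
      ContDiff ℝ ∞ (fun x => ViscousFlow.artificialLF c (lam + 2 * μ) χ t x i j)) ∧
    -- the case `2 ≤ p ≤ ∞`
    (∀ σ : Fin 2 → ℕ, ∃ C : ℝ, 0 < C ∧
      ∀ t : ℝ, 1 ≤ t → ∀ p : ℝ≥0∞, 2 ≤ p → ∀ i j : ViscousFlow.StateIdx,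
        MeasureTheory.eLpNorm
          (ViscousFlow.multiDeriv σ fun x =>
            (ViscousFlow.curlFreeLF c (lam + 2 * μ) χ t x
              - ViscousFlow.artificialLF c (lam + 2 * μ) χ t x) i j)
          p MeasureTheory.volume
        ≤ ENNReal.ofReal
            (C * t ^ (-(1 - (p⁻¹).toReal + (ViscousFlow.multiLength σ : ℝ) / 2 + 1 / 2)))) ∧
    -- the case `1 ≤ p ≤ 2`
    (∀ σ : Fin 2 → ℕ, ∀ θ : ℝ, 0 < θ → ∃ C : ℝ, 0 < C ∧
      ∀ t : ℝ, 1 ≤ t → ∀ p : ℝ≥0∞, 1 ≤ p → p ≤ 2 → ∀ i j : ViscousFlow.StateIdx,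
        MeasureTheory.eLpNorm
          (ViscousFlow.multiDeriv σ fun x =>
            (ViscousFlow.curlFreeLF c (lam + 2 * μ) χ t x
              - ViscousFlow.artificialLF c (lam + 2 * μ) χ t x) i j)
          p MeasureTheory.volume
        ≤ ENNReal.ofReal
            (C * t ^ (-(5 / 4 - 3 / 2 * (p⁻¹).toReal
              + (ViscousFlow.multiLength σ : ℝ) / 2 + 1 / 2 - θ)))) := by
  
  have hν : 0 < lam + 2 * μ := hlam
  refine ⟨fun t _ i j => ⟨?_, ?_⟩, fun σ => ?_, fun σ θ hθ => ?_⟩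
  · rw [ViscousFlow.curlFreeLF_entry hν]
    exact ViscousFlow.contDiff_invFourier (hχ.continuous_mul_regularSymbol _ _ _ _ i j)
      (hχ.hasCompactSupport_mul _)
  · rw [ViscousFlow.artificialLF_entry hc hν]
    exact ViscousFlow.contDiff_invFourier (hχ.continuous_mul_regularSymbol _ _ _ _ i j)
      (hχ.hasCompactSupport_mul _)
  · choose K hK hb using ViscousFlow.exists_kernel_bound hc hν hR₀ hχ σ
    obtain ⟨C, hC0, hC⟩ := ViscousFlow.exists_entry_bound K
    refine ⟨C, hC0, fun t ht p hp i j => ?_⟩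
    obtain ⟨-, b2, b3, b4, -⟩ := hb i j t ht _ rfl
    refine (ViscousFlow.eLpNorm_le_of_two_le (hK i j) ht b2 b3 b4 hp).trans
      (ENNReal.ofReal_le_ofReal ?_)
    have e : -(1 + (ViscousFlow.multiLength σ : ℝ)) / 2 - 1 + (p⁻¹).toReal =
        -(1 - (p⁻¹).toReal + (ViscousFlow.multiLength σ : ℝ) / 2 + 1 / 2) := by ring
    rw [e]
    gcongr
    exact hC i j
  · choose K hK hb using ViscousFlow.exists_kernel_bound hc hν hR₀ hχ σ
    obtain ⟨C, hC0, hC⟩ := ViscousFlow.exists_entry_bound K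
    refine ⟨2 * C, by positivity, fun t ht p hp1 hp2 i j => ?_⟩
    obtain ⟨b1, b2, -, b4, b5⟩ := hb i j t ht _ rfl
    refine (ViscousFlow.eLpNorm_le_of_le_two (hK i j) ht b1 b2 b4 b5 hp1 hp2).trans
      (ENNReal.ofReal_le_ofReal ?_)
    -- the estimate holds without the loss `θ`
    gcongr
    · exact hC i j
    · linarith
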